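/- **Theorem (fast-sampling/fast-hold approximation of the DPCM error systems).** Let $h>0$, $m\in\mathbb N$ and $L=mh$. Let $W(s)=C(sI-A)^{-1}B$ be a rational, strictly proper, scalar real analog filter, acting with zero initial state by $(Ww)(t)=\int_0^t Ce^{A(t-\tau)}Bw(\tau)\,d\tau$, and let $K_1(z),K_2(z),W_d(z),W_n(z)$ be rational, proper, scalar real discrete-time filters, acting on sequences with zero initial state. Assume that the encoder loop is well posed, i.e. $1+K_1(\infty)\neq 0$. No stability is assumed. Let $\mathcal S_h$ be the ideal sampler, $(\mathcal S_hu)[k]=u(kh)$, and $\mathcal H_h$ the zero-order hold, $(\mathcal H_hv)(kh+\theta)=v[k]$ for $0\le\theta<h$. *Error systems.* For $w\in L^2=L^2[0,\infty)$ and $d,n\in l^2$, the encoder error $e$ is defined by the feedback equation $$e=\mathcal S_hWw-K_1(e+W_dd),$$ and the decoder error $e_r$ is the signal $$e_r=\mathcal H_hK_2\,(e+W_dd+W_nn)-e^{-Ls}Ww .$$ Let $\mathcal T_1:(w,d)\mapsto e$ and $\mathcal T_2:(w,d,n)\mapsto e_r$. With $\|e_r\|_{l^2}$ denoting the $l^2$-norm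 of the samples $e_r(kh)$, $k\ge 0$, define in $[0,\infty]$ (a sequence that is not square summable having $l^2$-norm $\infty$) $$\|\mathcal T_1\|^2=\sup_{\|w\|_{L^2}+\|d\|_{l^2}\ne0}\frac{\|e\|_{l^2}^2}{\|w\|_{L^2}^2+\|d\|_{l^2}^2},\qquad \|\mathcal T_2\|^2=\sup_{\|w\|_{L^2}+\|d\|_{l^2}+\|n\|_{l^2}\ne0}\frac{\|e_r\|_{l^2}^2}{\|w\|_{L^2}^2+\|d\|_{l^2}^2+\|n\|_{l^2}^2}.$$ *Approximants.* For $N\ge1$ let $\mathbf L_N$ be the discrete-time lifting, which groups a scalar sequence into consecutive blocks of length $N$, and put $$W_{dN}=\mathbf L_N\,\mathcal S_{h/N}\,W\,\mathcal H_{h/N}\,\mathbf L_N^{-1},\qquad \widetilde W_N=[1,0,\dots,0]\,W_{dN},\qquad S_d=(1+K_1)^{-1},$$ $$G_{1,N}=\begin{bmatrix}[\widetilde W_N,\,0]&-1\\ [\widetilde W_N,\,W_d]&-1\end{bmatrix},\qquad G_{2,N}=\begin{bmatrix}[z^{-m}\widetilde W_N,\,0,\,0]&-1\\ [S_d\widetilde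 W_N,\,S_dW_d,\,W_n]&0\end{bmatrix}.$$ With $\mathcal F_l(G,K)=G_{11}+G_{12}K(I-G_{22}K)^{-1}G_{21}$, let $T_{1,N}=\mathcal F_l(G_{1,N},K_1)$, with input $(\widetilde w,d)$, and $T_{2,N}=\mathcal F_l(G_{2,N},K_2)$, with input $(\widetilde w,d,n)$, where $\widetilde w$ is an $\mathbb R^N$-valued $l^2$ sequence. Their norms in $[0,\infty]$ are $$\|T_{1,N}\|^2=\sup_{\|\widetilde w\|_{l^2}+\|d\|_{l^2}\ne0}\frac{\|T_{1,N}(\widetilde w,d)\|_{l^2}^2}{\frac hN\|\widetilde w\|_{l^2}^2+\|d\|_{l^2}^2},\qquad \|T_{2,N}\|^2=\sup_{\|\widetilde w\|_{l^2}+\|d\|_{l^2}+\|n\|_{l^2}\ne0}\frac{\|T_{2,N}(\widetilde w,d,n)\|_{l^2}^2}{\frac hN\|\widetilde w\|_{l^2}^2+\|d\|_{l^2}^2+\|n\|_{l^2}^2}.$$ *Conclusion.* The systems $\mathcal T_1,\mathcal T_2$ are well defined: for all $w\in L^2$, $d,n\in l^2$ there are exactly one $e$ and exactly one $e_r$ as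 above. For every $N\ge1$ the systems $W_{dN}$, $T_{1,N}$ and $T_{2,N}$ are finite-dimensional discrete-time systems, i.e. they have finite-dimensional (causal, time-invariant) state-space realizations, and $$\lim_{N\to\infty}\|T_{1,N}\|=\|\mathcal T_1\|,\qquad \lim_{N\to\infty}\|T_{2,N}\|=\|\mathcal T_2\| .$$ -/

import Mathlib

open MeasureTheory Filter Topology
open scoped ENNReal Matrix

/-- A finite-dimensional linear time-invariant discrete-time system
`x[k+1] = A x[k] + B u[k]`, `y[k] = C x[k] + D u[k]`,
with input channels indexed by `ι` and output channels indexed by `κ`. -/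
structure DTSystem (ι κ : Type) where
  dim : ℕ
  A : Matrix (Fin dim) (Fin dim) ℝ
  B : Matrix (Fin dim) ι ℝ
  C : Matrix κ (Fin dim) ℝ
  D : Matrix κ ι ℝ

/-- A finite-dimensional, strictly proper, single-input single-output continuous-time filter
`x' = A x + B w`, `y = C x`, that is `W(s) = C (sI - A)⁻¹ B`. -/
structure AnalogFilter where
  dim : ℕ
  A : Matrix (Fin dim) (Fin dim) ℝ
  B : Fin dim → ℝ
  C : Fin dim → ℝ

noncomputable section

namespace DTSystem

variable {ι κ : Type} [Fintype ι]

/-- The state trajectory started at the origin. -/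
def state (S : DTSystem ι κ) (u : ℕ → ι → ℝ) : ℕ → Fin S.dim → ℝ
  | 0 => 0
  | k + 1 => S.A *ᵥ state S u k + S.B *ᵥ u k

/-- The output sequence (zero initial state). -/
def output (S : DTSystem ι κ) (u : ℕ → ι → ℝ) (k : ℕ) : κ → ℝ :=
  S.C *ᵥ S.state u k + S.D *ᵥ u k

/-- The transfer matrix `D + C (zI - A)⁻¹ B`, a matrix of rational functions of `z`. -/
def transfer (S : DTSystem ι κ) : Matrix κ ι (RatFunc ℝ) :=
  S.D.map RatFunc.C +
    S.C.map RatFunc.C *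
      ((RatFunc.X : RatFunc ℝ) • (1 : Matrix (Fin S.dim) (Fin S.dim) (RatFunc ℝ))
        - S.A.map RatFunc.C)⁻¹ * S.B.map RatFunc.C

/-- A scalar filter acting on a scalar sequence. -/
def filter (S : DTSystem Unit Unit) (v : ℕ → ℝ) (k : ℕ) : ℝ :=
  S.output (fun j _ => v j) k ()

end DTSystem

/-- The zero-initial-state response
`(W w)(t) = ∫₀ᵗ C e^{A(t-τ)} B w(τ) dτ` for `t ≥ 0`, and `0` for `t < 0`. -/
def AnalogFilter.response (W : AnalogFilter) (w : ℝ → ℝ) (t : ℝ) : ℝ :=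
  if 0 ≤ t then
    ∫ τ in (0 : ℝ)..t, (W.C ⬝ᵥ (NormedSpace.exp ((t - τ) • W.A) *ᵥ W.B)) * w τ
  else 0

/-- The pure delay `e^{-Ls}` of signals on the half-line `[0, ∞)`. -/
def delay (L : ℝ) (y : ℝ → ℝ) (t : ℝ) : ℝ :=
  if L ≤ t then y (t - L) else 0

/-- The ideal sampler with period `h`. -/
def sampler (h : ℝ) (u : ℝ → ℝ) (k : ℕ) : ℝ := u (k * h)

/-- The zero-order hold with period `h`: `u(kh + θ) = v[k]` for `0 ≤ θ < h`. -/
def hold (h : ℝ) (v : ℕ → ℝ) (t : ℝ) : ℝ :=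
  if 0 ≤ t then v ⌊t / h⌋₊ else 0

/-- Discrete-time lifting: the `k`-th block is `(v[kN], …, v[kN+N-1])`. -/
def dlift (N : ℕ) (v : ℕ → ℝ) (k : ℕ) (i : Fin N) : ℝ := v (k * N + i)

/-- Inverse discrete-time lifting (for `N ≥ 1`). -/
def idlift (N : ℕ) (V : ℕ → Fin N → ℝ) (j : ℕ) : ℝ :=
  if hN : 0 < N then V (j / N) ⟨j % N, Nat.mod_lt j hN⟩ else 0

/-- The fast-sampled, fast-held and lifted version of the analog filter `W`: the composition of
inverse lifting, the hold with period `h/N`, `W`, the sampler with period `h/N`, and lifting. -/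
def fastLifted (W : AnalogFilter) (h : ℝ) (N : ℕ) (V : ℕ → Fin N → ℝ) : ℕ → Fin N → ℝ :=
  dlift N (sampler (h / N) (W.response (hold (h / N) (idlift N V))))

/-- `‖v‖²` in `ℓ²`, equal to `∞` if `v` is not square summable. -/
def energy (v : ℕ → ℝ) : ℝ≥0∞ := ∑' k, ‖v k‖ₑ ^ 2

/-- `‖V‖²` in `ℓ²` for a vector-valued sequence (Euclidean norm in each block). -/
def energyVec {N : ℕ} (V : ℕ → Fin N → ℝ) : ℝ≥0∞ := ∑' k, ∑ i, ‖V k i‖ₑ ^ 2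

/-- `‖w‖²` in `L²[0, ∞)`. -/
def energyCT (w : ℝ → ℝ) : ℝ≥0∞ := eLpNorm w 2 (volume.restrict (Set.Ici 0)) ^ 2

/-- Membership in `L²[0, ∞)`. -/
def IsL2 (w : ℝ → ℝ) : Prop := MemLp w 2 (volume.restrict (Set.Ici 0))

/-- Membership in `ℓ²`. -/
def IsEll2 (v : ℕ → ℝ) : Prop := Memℓp v 2

/-- The encoder error system: `e` is the sampled signal `S_h W w` minus the prediction
`K₁ ê`, where `ê = e + W_d d` is the (additively modelled) quantized signal. -/
def EncoderError (h : ℝ) (W : AnalogFilter) (K₁ Wd : DTSystem Unit Unit)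
    (w : ℝ → ℝ) (d e : ℕ → ℝ) : Prop :=
  ∀ k, e k = sampler h (W.response w) k - K₁.filter (e + Wd.filter d) k

/-- The decoder error system: the transmitted signal `ê = e + W_d d` is corrupted by the channel
noise `W_n n`, filtered by `K₂`, held, and compared with the delayed analog signal. -/
def DecoderError (h L : ℝ) (W : AnalogFilter) (K₁ K₂ Wd Wn : DTSystem Unit Unit)
    (w : ℝ → ℝ) (d n : ℕ → ℝ) (er : ℝ → ℝ) : Prop :=
  ∃ e, EncoderError h W K₁ Wd w d e ∧
    ∀ t, er t = hold h (K₂.filter (e + Wd.filter d + Wn.filter n)) t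
      - delay L (W.response w) t

/-- `‖𝒯₁‖`: the gain from `(w, d) ∈ L² × ℓ²` to `e`, measured in `ℓ²`, with value in `[0, ∞]`. -/
def encoderNorm (h : ℝ) (W : AnalogFilter) (K₁ Wd : DTSystem Unit Unit) : ℝ≥0∞ :=
  (⨆ (w : ℝ → ℝ) (d : ℕ → ℝ) (e : ℕ → ℝ) (_ : IsL2 w) (_ : IsEll2 d)
    (_ : energyCT w + energy d ≠ 0) (_ : EncoderError h W K₁ Wd w d e),
    energy e / (energyCT w + energy d)) ^ (1 / 2 : ℝ)

/-- `‖𝒯₂‖`: the gain from `(w, d, n) ∈ L² × ℓ² × ℓ²` to the error `e_r` at the sampling instants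
`kh`, measured in `ℓ²`, with value in `[0, ∞]`. -/
def decoderNorm (h L : ℝ) (W : AnalogFilter) (K₁ K₂ Wd Wn : DTSystem Unit Unit) : ℝ≥0∞ :=
  (⨆ (w : ℝ → ℝ) (d : ℕ → ℝ) (n : ℕ → ℝ) (er : ℝ → ℝ) (_ : IsL2 w) (_ : IsEll2 d)
    (_ : IsEll2 n) (_ : energyCT w + energy d + energy n ≠ 0)
    (_ : DecoderError h L W K₁ K₂ Wd Wn w d n er),
    energy (sampler h er) / (energyCT w + energy d + energy n)) ^ (1 / 2 : ℝ)

/-- The gain of a discrete-time system from `(w̃, d)` to a scalar output. The lifted fast-rate input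
`w̃` is weighted by `h/N`, so that its weighted energy is the `L²` energy of the held signal. -/
def approxNorm₁ (h : ℝ) (N : ℕ) (T : DTSystem (Fin N ⊕ Unit) Unit) : ℝ≥0∞ :=
  (⨆ (V : ℕ → Fin N → ℝ) (d : ℕ → ℝ) (_ : energyVec V ≠ ∞) (_ : IsEll2 d)
    (_ : energyVec V + energy d ≠ 0),
    energy (fun k => T.output (fun j => Sum.elim (V j) (fun _ => d j)) k ()) /
      (ENNReal.ofReal (h / N) * energyVec V + energy d)) ^ (1 / 2 : ℝ)

/-- The gain of a discrete-time system from `(w̃, d, n)` to a scalar output, with the same weight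
`h/N` on the lifted fast-rate input `w̃`. -/
def approxNorm₂ (h : ℝ) (N : ℕ) (T : DTSystem (Fin N ⊕ (Unit ⊕ Unit)) Unit) : ℝ≥0∞ :=
  (⨆ (V : ℕ → Fin N → ℝ) (d : ℕ → ℝ) (n : ℕ → ℝ) (_ : energyVec V ≠ ∞) (_ : IsEll2 d)
    (_ : IsEll2 n) (_ : energyVec V + energy d + energy n ≠ 0),
    energy (fun k => T.output
      (fun j => Sum.elim (V j) (Sum.elim (fun _ => d j) (fun _ => n j))) k ()) /
      (ENNReal.ofReal (h / N) * energyVec V + energy d + energy n)) ^ (1 / 2 : ℝ)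

/-- The (lower) linear fractional transformation
`F_l(G, K) = G₁₁ + G₁₂ K (I - G₂₂ K)⁻¹ G₂₁`. -/
def lft {R ι κ μ ν : Type} [CommRing R] [Fintype μ] [Fintype ν] [DecidableEq ν]
    (G : Matrix (κ ⊕ ν) (ι ⊕ μ) R) (K : Matrix μ ν R) : Matrix κ ι R :=
  G.toBlocks₁₁ + G.toBlocks₁₂ * K * (1 - G.toBlocks₂₂ * K)⁻¹ * G.toBlocks₂₁

/-- The row `[1, 0, …, 0]` of length `N`. -/
def firstRow (N : ℕ) : Matrix Unit (Fin N) (RatFunc ℝ) :=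
  Matrix.of fun _ j => if (j : ℕ) = 0 then 1 else 0

/-- The encoder generalized plant
`G_{1,N} = [[ [W̃, 0], -1 ], [ [W̃, W_d], -1 ]]`, where `W̃` is the row `[1, 0, …, 0] · WN`. -/
def plant₁ {N : ℕ} (WN : Matrix (Fin N) (Fin N) (RatFunc ℝ)) (Wd : DTSystem Unit Unit) :
    Matrix (Unit ⊕ Unit) ((Fin N ⊕ Unit) ⊕ Unit) (RatFunc ℝ) :=
  Matrix.fromBlocks
    (Matrix.fromCols (firstRow N * WN) 0) (-1)
    (Matrix.fromCols (firstRow N * WN) Wd.transfer) (-1)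

/-- The sensitivity `S_d = (1 + K₁)⁻¹`. -/
def sensitivity (K₁ : DTSystem Unit Unit) : Matrix Unit Unit (RatFunc ℝ) :=
  (1 + K₁.transfer)⁻¹

/-- The decoder generalized plant
`G_{2,N} = [[ [z^{-m} W̃, 0, 0], -1 ], [ [S_d W̃, S_d W_d, W_n], 0 ]]`,
where `W̃` is the row `[1, 0, …, 0] · WN`. -/
def plant₂ {N : ℕ} (m : ℕ) (WN : Matrix (Fin N) (Fin N) (RatFunc ℝ))
    (K₁ Wd Wn : DTSystem Unit Unit) :
    Matrix (Unit ⊕ Unit) ((Fin N ⊕ (Unit ⊕ Unit)) ⊕ Unit) (RatFunc ℝ) :=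
  Matrix.fromBlocks
    (Matrix.fromCols ((RatFunc.X : RatFunc ℝ)⁻¹ ^ m • (firstRow N * WN)) 0) (-1)
    (Matrix.fromCols (sensitivity K₁ * (firstRow N * WN))
      (Matrix.fromCols (sensitivity K₁ * Wd.transfer) Wn.transfer)) 0

end

/-! For every N ≥ 1 the approximate gain is the true gain restricted to analog inputs that are
constant on cells of length h/N. Holding a sequence at rate h/N multiplies its energy by h/N
(`energyCT_hold`), which is exactly the weight in the approximate norms, and the first row of the
lifted filter returns the samples at kh of the response to the held signal (`fastLifted_first`).
Hence no approximate gain exceeds the true one.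

Conversely, replace an input w by its cell averages. By Cauchy–Schwarz this does not increase the
energy (`energy_cellAverage_le`), and at each fixed instant kh the response converges to that of w,
because the impulse response is uniformly continuous on [0, kh] (`tendsto_response_cellAverage`). By
causality each error sample depends continuously on the sampled responses, so every finite partial
sum of the error energy converges. Since the energy is the supremum of these partial sums, the limit
inferior of the approximate gains is at least the true gain (`tendsto_gain`). Only finite horizons
are compared, so no stability is needed and infinite gains are covered.

The algebraic half is that the linear fractional transformations are transfer matrices of systems
with the right input-output maps. `Realizes` carries both at once and is preserved by sums,
cascades, column concatenation and delays; `exists_sensitivity` closes the encoder loop, giving both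
(1 + K₁)⁻¹ and unique solvability of the feedback equation. -/

noncomputable section

/-! ### Realizations: transfer matrices paired with input-output maps -/

namespace DTSystem

variable {ι κ μ : Type} [Fintype ι]

/-- The determinant is the characteristic polynomial of `A`, which is monic and hence nonzero as a
rational function. -/
theorem isUnit_resolvent {σ : Type} [Fintype σ] [DecidableEq σ] (A : Matrix σ σ ℝ) :
    IsUnit ((RatFunc.X : RatFunc ℝ) • (1 : Matrix σ σ (RatFunc ℝ)) - A.map RatFunc.C) := by
  have h : (RatFunc.X : RatFunc ℝ) • (1 : Matrix σ σ (RatFunc ℝ)) - A.map RatFunc.C =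
      A.charmatrix.map (algebraMap (Polynomial ℝ) (RatFunc ℝ)) := by
    ext i j
    by_cases hij : i = j
    · subst hij; simp [Matrix.charmatrix]
    · simp [Matrix.charmatrix, hij]
  rw [Matrix.isUnit_iff_isUnit_det, h, ← RingHom.mapMatrix_apply, ← RingHom.map_det, isUnit_iff_ne_zero]
  exact (map_ne_zero_iff _ (RatFunc.algebraMap_injective ℝ)).2 A.charpoly_monic.ne_zero

/-- The transfer matrix computed from any solution of `(zI - A) Z = B`. -/
theorem transfer_eq {ι : Type} (S : DTSystem ι κ) (Z : Matrix (Fin S.dim) ι (RatFunc ℝ))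
    (hZ : ((RatFunc.X : RatFunc ℝ) • (1 : Matrix (Fin S.dim) (Fin S.dim) (RatFunc ℝ))
        - S.A.map RatFunc.C) * Z = S.B.map RatFunc.C) :
    S.transfer = S.D.map RatFunc.C + S.C.map RatFunc.C * Z := by
  have hu := (Matrix.isUnit_iff_isUnit_det _).1 (isUnit_resolvent S.A)
  rw [transfer, ← hZ, Matrix.mul_assoc, ← Matrix.mul_assoc _ _ Z, Matrix.nonsing_inv_mul _ hu,
    Matrix.one_mul]

/-- Working with a solution `Z` of a linear equation spares the interconnection lemmas any inversion
of block matrices: it suffices to stack the solutions of the parts. -/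
theorem exists_resolvent {ι : Type} (S : DTSystem ι κ) : ∃ Z : Matrix (Fin S.dim) ι (RatFunc ℝ),
    ((RatFunc.X : RatFunc ℝ) • (1 : Matrix (Fin S.dim) (Fin S.dim) (RatFunc ℝ))
        - S.A.map RatFunc.C) * Z = S.B.map RatFunc.C ∧
    S.transfer = S.D.map RatFunc.C + S.C.map RatFunc.C * Z := by
  have hu := (Matrix.isUnit_iff_isUnit_det _).1 (isUnit_resolvent S.A)
  have hZ := Matrix.mul_nonsing_inv_cancel_left _ (S.B.map RatFunc.C) hu
  exact ⟨_, hZ, S.transfer_eq _ hZ⟩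

/-- A transfer matrix together with an input-output map that are simultaneously realized by one
finite-dimensional system. -/
def Realizes (T : Matrix κ ι (RatFunc ℝ)) (F : (ℕ → ι → ℝ) → ℕ → κ → ℝ) : Prop :=
  ∃ S : DTSystem ι κ, S.transfer = T ∧ ∀ u, S.output u = F u

theorem fromBlocks_resolvent {σ τ : Type} [DecidableEq σ] [DecidableEq τ]
    (A : Matrix σ σ ℝ) (B : Matrix σ τ ℝ) (C : Matrix τ σ ℝ) (D : Matrix τ τ ℝ) :
    (RatFunc.X : RatFunc ℝ) • (1 : Matrix (σ ⊕ τ) (σ ⊕ τ) (RatFunc ℝ)) -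
      (Matrix.fromBlocks A B C D).map RatFunc.C =
    Matrix.fromBlocks ((RatFunc.X : RatFunc ℝ) • 1 - A.map RatFunc.C) (-B.map RatFunc.C)
      (-C.map RatFunc.C) ((RatFunc.X : RatFunc ℝ) • 1 - D.map RatFunc.C) := by
  rw [← Matrix.fromBlocks_one, Matrix.fromBlocks_smul, Matrix.fromBlocks_map, sub_eq_add_neg,
    Matrix.fromBlocks_neg, Matrix.fromBlocks_add]
  simp [sub_eq_add_neg]

/-- State-space realizations may use any finite type of state coordinates. -/
theorem Realizes.of_states {σ : Type} [Fintype σ] [DecidableEq σ]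
    (A : Matrix σ σ ℝ) (B : Matrix σ ι ℝ) (C : Matrix κ σ ℝ) (D : Matrix κ ι ℝ)
    (Z : Matrix σ ι (RatFunc ℝ))
    (hZ : ((RatFunc.X : RatFunc ℝ) • (1 : Matrix σ σ (RatFunc ℝ)) - A.map RatFunc.C) * Z =
      B.map RatFunc.C)
    (x : (ℕ → ι → ℝ) → ℕ → σ → ℝ) (hx0 : ∀ u, x u 0 = 0)
    (hx : ∀ u k, x u (k + 1) = A *ᵥ x u k + B *ᵥ u k) :
    Realizes (D.map RatFunc.C + C.map RatFunc.C * Z)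
      (fun u k => C *ᵥ x u k + D *ᵥ u k) := by
  let f := Fintype.equivFin σ
  let S : DTSystem ι κ := ⟨Fintype.card σ, A.submatrix f.symm f.symm, B.submatrix f.symm id,
    C.submatrix id f.symm, D⟩
  refine ⟨S, ?_, ?_⟩
  · rw [S.transfer_eq (Z.submatrix f.symm id)]
    · congr 1
      change (C.map RatFunc.C).submatrix id f.symm * Z.submatrix f.symm id = _
      rw [Matrix.submatrix_mul_equiv]
      rfl
    · change ((RatFunc.X : RatFunc ℝ) • (1 : Matrix (Fin (Fintype.card σ)) _ (RatFunc ℝ)) -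
        (A.map RatFunc.C).submatrix f.symm f.symm) * Z.submatrix f.symm id =
          (B.map RatFunc.C).submatrix f.symm id
      rw [← hZ, ← Matrix.submatrix_mul_equiv _ _ _ f.symm]
      congr 1
      ext i j
      simp [Matrix.one_apply]
  · intro u
    have hs : ∀ k, S.state u k = x u k ∘ f.symm := by
      intro k
      induction k with
      | zero => rw [hx0]; rfl
      | succ k ih =>
        change A.submatrix f.symm f.symm *ᵥ S.state u k + B.submatrix f.symm id *ᵥ u k = _
        rw [ih, hx, Matrix.submatrix_mulVec_equiv]
        ext i
        simp [Function.comp_def, Matrix.mulVec, dotProduct]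
    ext k : 1
    change C.submatrix id f.symm *ᵥ S.state u k + D *ᵥ u k = _
    rw [hs, Matrix.submatrix_mulVec_equiv]
    ext i
    simp [Function.comp_def]

theorem realizes (S : DTSystem ι κ) : Realizes S.transfer S.output := ⟨S, rfl, fun _ => rfl⟩

theorem realizes_static (D : Matrix κ ι ℝ) :
    Realizes (D.map RatFunc.C) (fun u k => D *ᵥ u k) := by
  have := Realizes.of_states (σ := Fin 0) 0 0 (0 : Matrix κ (Fin 0) ℝ) D 0
    (by ext i; exact i.elim0) (fun _ _ => 0) (fun _ => rfl) (fun _ _ => by ext i; exact i.elim0)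
  simpa using this

theorem Realizes.add {T₁ T₂ : Matrix κ ι (RatFunc ℝ)} {F₁ F₂ : (ℕ → ι → ℝ) → ℕ → κ → ℝ}
    (h₁ : Realizes T₁ F₁) (h₂ : Realizes T₂ F₂) : Realizes (T₁ + T₂) (F₁ + F₂) := by
  obtain ⟨S₁, rfl, hF₁⟩ := h₁
  obtain ⟨S₂, rfl, hF₂⟩ := h₂
  obtain rfl : S₁.output = F₁ := funext hF₁
  obtain rfl : S₂.output = F₂ := funext hF₂
  obtain ⟨Z₁, hZ₁, hT₁⟩ := S₁.exists_resolvent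
  obtain ⟨Z₂, hZ₂, hT₂⟩ := S₂.exists_resolvent
  have := Realizes.of_states (Matrix.fromBlocks S₁.A 0 0 S₂.A) (Matrix.fromRows S₁.B S₂.B)
    (Matrix.fromCols S₁.C S₂.C) (S₁.D + S₂.D) (Matrix.fromRows Z₁ Z₂)
    (by
      rw [fromBlocks_resolvent, Matrix.fromBlocks_mul_fromRows, Matrix.fromRows_map, ← hZ₁, ← hZ₂]
      simp)
    (fun u k => Sum.elim (S₁.state u k) (S₂.state u k))
    (fun u => by ext (i | i) <;> rfl)
    (fun u k => by
      rw [Matrix.fromBlocks_mulVec, Matrix.fromRows_mulVec]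
      ext (i | i) <;> simp [state])
  convert this using 1
  · rw [hT₁, hT₂, Matrix.fromCols_map, Matrix.fromCols_mul_fromRows,
      Matrix.map_add _ (map_add _)]
    abel
  · ext u k i
    simp only [Pi.add_apply, output, Matrix.fromCols_mulVec, Sum.elim_comp_inl,
      Sum.elim_comp_inr, Matrix.add_mulVec]
    ring

theorem Realizes.comp [Fintype κ] {T₁ : Matrix κ ι (RatFunc ℝ)} {T₂ : Matrix μ κ (RatFunc ℝ)}
    {F₁ : (ℕ → ι → ℝ) → ℕ → κ → ℝ} {F₂ : (ℕ → κ → ℝ) → ℕ → μ → ℝ}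
    (h₂ : Realizes T₂ F₂) (h₁ : Realizes T₁ F₁) : Realizes (T₂ * T₁) (F₂ ∘ F₁) := by
  obtain ⟨S₁, rfl, hF₁⟩ := h₁
  obtain ⟨S₂, rfl, hF₂⟩ := h₂
  obtain rfl : S₁.output = F₁ := funext hF₁
  obtain rfl : S₂.output = F₂ := funext hF₂
  obtain ⟨Z₁, hZ₁, hT₁⟩ := S₁.exists_resolvent
  obtain ⟨Z₂, hZ₂, hT₂⟩ := S₂.exists_resolvent
  -- Cascade: the second state is driven by the output of the first system, so its resolvent
  -- solution is `Z₂` times the first transfer matrix.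
  have := Realizes.of_states (Matrix.fromBlocks S₁.A 0 (S₂.B * S₁.C) S₂.A)
    (Matrix.fromRows S₁.B (S₂.B * S₁.D))
    (Matrix.fromCols (S₂.D * S₁.C) S₂.C) (S₂.D * S₁.D) (Matrix.fromRows Z₁ (Z₂ * S₁.transfer))
    (by
      rw [fromBlocks_resolvent, Matrix.fromBlocks_mul_fromRows, Matrix.fromRows_map, ← hZ₁,
        ← Matrix.mul_assoc _ Z₂ S₁.transfer, ← Matrix.mul_assoc _ Z₂ S₁.transfer, hZ₂, hT₁,
        Matrix.map_mul, Matrix.map_mul, Matrix.mul_add]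
      simp [Matrix.mul_assoc, Matrix.mul_add])
    (fun u k => Sum.elim (S₁.state u k) (S₂.state (S₁.output u) k))
    (fun u => by ext (i | i) <;> rfl)
    (fun u k => by
      rw [Matrix.fromBlocks_mulVec, Matrix.fromRows_mulVec]
      ext (i | i)
      · simp [state]
      · simp [state, output, Matrix.mulVec_add]
        ring)
  convert this using 1
  · rw [hT₂, Matrix.fromCols_map, Matrix.fromCols_mul_fromRows, Matrix.add_mul, hT₁, Matrix.mul_add,
      Matrix.map_mul, Matrix.map_mul]
    simp only [Matrix.mul_assoc, Matrix.mul_add]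
    abel
  · ext u k i
    simp only [Pi.add_apply, output, Matrix.fromCols_mulVec, Sum.elim_comp_inl,
      Sum.elim_comp_inr, Matrix.mulVec_add,
      Function.comp_apply, Matrix.mulVec_mulVec]
    ring

/-- Static selector matrices extract each group of channels; the two responses are then added. -/
theorem Realizes.fromCols {ι' : Type} [Fintype ι']
    {T₁ : Matrix κ ι (RatFunc ℝ)} {T₂ : Matrix κ ι' (RatFunc ℝ)}
    {F₁ : (ℕ → ι → ℝ) → ℕ → κ → ℝ} {F₂ : (ℕ → ι' → ℝ) → ℕ → κ → ℝ}
    (h₁ : Realizes T₁ F₁) (h₂ : Realizes T₂ F₂) :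
    Realizes (Matrix.fromCols T₁ T₂)
      (fun u => F₁ (fun j i => u j (Sum.inl i)) + F₂ (fun j i => u j (Sum.inr i))) := by
  classical
  have h := (h₁.comp (realizes_static (Matrix.fromCols (1 : Matrix ι ι ℝ) (0 : Matrix ι ι' ℝ)))).add
    (h₂.comp (realizes_static (Matrix.fromCols (0 : Matrix ι' ι ℝ) (1 : Matrix ι' ι' ℝ))))
  convert h using 1
  · simp only [Matrix.fromCols_map, Matrix.mul_fromCols]
    ext i (j | j) <;> simp
  · ext u k i
    simp [Matrix.fromCols_mulVec, Function.comp_def]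

theorem realizes_zero : Realizes (0 : Matrix κ ι (RatFunc ℝ)) (fun _ => 0) := by
  convert realizes_static (0 : Matrix κ ι ℝ) using 1
  · simp
  · ext; simp

theorem realizes_neg_one [DecidableEq ι] : Realizes (-1 : Matrix ι ι (RatFunc ℝ)) (fun u => -u) := by
  convert realizes_static (-1 : Matrix ι ι ℝ) using 1
  · ext i j; by_cases h : i = j <;> simp [h]
  · ext u k i; simp [Matrix.neg_mulVec]

/-- Delay of a sequence by `m` steps. -/
def shift (m : ℕ) (y : ℕ → ℝ) (k : ℕ) : ℝ := if m ≤ k then y (k - m) else 0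

theorem realizes_delay : Realizes ((RatFunc.X : RatFunc ℝ)⁻¹ • (1 : Matrix Unit Unit (RatFunc ℝ)))
    (fun u k _ => shift 1 (fun j => u j ()) k) := by
  have := Realizes.of_states (0 : Matrix Unit Unit ℝ) (1 : Matrix Unit Unit ℝ)
    (1 : Matrix Unit Unit ℝ) 0
    ((RatFunc.X : RatFunc ℝ)⁻¹ • (1 : Matrix Unit Unit (RatFunc ℝ)))
    (by simp [smul_smul, RatFunc.X_ne_zero])
    (fun u k _ => shift 1 (fun j => u j ()) k) (fun u => by ext; simp [shift])
    (fun u k => by ext; simp [shift])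
  convert this using 1
  · simp
  · ext; simp

theorem shift_zero (y : ℕ → ℝ) : shift 0 y = y := by ext; simp [shift]

theorem shift_shift_one (m : ℕ) (y : ℕ → ℝ) : shift 1 (shift m y) = shift (m + 1) y := by
  ext k
  simp only [shift]
  by_cases h : m + 1 ≤ k
  · rw [if_pos (by omega), if_pos (by omega), if_pos h]
    congr 1; omega
  · by_cases h1 : 1 ≤ k
    · rw [if_pos h1, if_neg (by omega), if_neg h]
    · rw [if_neg h1, if_neg h]

theorem Realizes.delay {T : Matrix Unit ι (RatFunc ℝ)} {F : (ℕ → ι → ℝ) → ℕ → Unit → ℝ}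
    (hT : Realizes T F) (m : ℕ) :
    Realizes ((RatFunc.X : RatFunc ℝ)⁻¹ ^ m • T)
      (fun u k _ => shift m (fun j => F u j ()) k) := by
  induction m with
  | zero => simpa [shift_zero] using hT
  | succ m ih =>
    convert realizes_delay.comp ih using 1
    · rw [Matrix.smul_mul, Matrix.one_mul, smul_smul, pow_succ']
    · ext u k i
      simp only [Function.comp_apply]
      rw [← shift_shift_one]

/-- Well-posed unit feedback around a scalar system. -/
theorem exists_sensitivity (S : DTSystem Unit Unit) (hS : 1 + S.D () () ≠ 0) :
    ∃ R : DTSystem Unit Unit, R.transfer = (1 + S.transfer)⁻¹ ∧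
      ∀ u v : ℕ → ℝ, v + S.filter v = u ↔ v = R.filter u := by
  obtain ⟨Z, hZ, hT⟩ := S.exists_resolvent
  set c : ℝ := (1 + S.D () ())⁻¹
  have hc1 : c * (1 + S.D () ()) = 1 := inv_mul_cancel₀ hS
  -- Solving v + Cx + Dv = u for v gives v = c(u - Cx); substituting this into x⁺ = Ax + Bv yields
  -- these four matrices.
  set R : DTSystem Unit Unit := ⟨S.dim, S.A - c • (S.B * S.C), c • S.B, -c • S.C, c • 1⟩ with hR
  refine ⟨R, ?_, ?_⟩
  · obtain ⟨Y, hY, hTR⟩ := R.exists_resolvent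
    set E := S.transfer
    have hsm : ∀ {α β : Type} (a : ℝ) (M : Matrix α β ℝ),
        (a • M).map RatFunc.C = RatFunc.C a • M.map (RatFunc.C : ℝ →+* RatFunc ℝ) := by
      intros; ext; simp
    have hD : S.D.map RatFunc.C = RatFunc.C (S.D () ()) • (1 : Matrix Unit Unit (RatFunc ℝ)) := by
      ext i j; simp
    have hkey : ((RatFunc.X : RatFunc ℝ) • (1 : Matrix (Fin S.dim) (Fin S.dim) (RatFunc ℝ)) -
        R.A.map RatFunc.C) = ((RatFunc.X : RatFunc ℝ) • 1 - S.A.map RatFunc.C) +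
          RatFunc.C c • (S.B.map RatFunc.C * S.C.map RatFunc.C) := by
      change _ - (S.A - c • (S.B * S.C)).map RatFunc.C = _
      rw [Matrix.map_sub _ (map_sub _), hsm, Matrix.map_mul]
      abel
    have hCc : RatFunc.C c * (1 + RatFunc.C (S.D () ())) = (1 : RatFunc ℝ) := by
      rw [← map_one RatFunc.C, ← map_add, ← map_mul, hc1]
    have hCZ : S.C.map RatFunc.C * Z = E - RatFunc.C (S.D () ()) • 1 := by
      rw [hT, hD]; abel
    -- Both sides solve the same equation for the closed-loop resolvent, which is invertible.
    have hZY : Z = Y * (1 + E) := by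
      have hu := isUnit_resolvent R.A
      have hinj : ∀ P Q : Matrix (Fin S.dim) Unit (RatFunc ℝ),
          ((RatFunc.X : RatFunc ℝ) • 1 - R.A.map RatFunc.C) * P =
            ((RatFunc.X : RatFunc ℝ) • 1 - R.A.map RatFunc.C) * Q →
            P = Q := by
        intro P Q h
        have hu := (Matrix.isUnit_iff_isUnit_det _).1 hu
        rw [← Matrix.nonsing_inv_mul_cancel_left _ P hu, h,
          Matrix.nonsing_inv_mul_cancel_left _ Q hu]
      apply hinj
      rw [← Matrix.mul_assoc, hY, hkey, Matrix.add_mul, hZ, Matrix.smul_mul, Matrix.mul_assoc, hCZ,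
        hsm, Matrix.smul_mul, Matrix.mul_sub, Matrix.mul_add, Matrix.mul_smul, Matrix.mul_one]
      ext i j
      simp only [Matrix.add_apply, Matrix.sub_apply, Matrix.smul_apply, smul_eq_mul]
      linear_combination - (S.B.map RatFunc.C) i j * hCc
    have hone : R.transfer * (1 + E) = 1 := by
      have h1 : R.transfer * (1 + E) = RatFunc.C c • (1 + E) -
          RatFunc.C c • (S.C.map RatFunc.C * Z) := by
        rw [hTR, Matrix.add_mul, Matrix.mul_assoc, ← hZY]
        simp only [hR]
        rw [hsm, hsm, Matrix.smul_mul, Matrix.smul_mul]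
        simp [sub_eq_add_neg]
      rw [h1, hCZ]
      ext i j
      simp only [Matrix.add_apply, Matrix.sub_apply, Matrix.smul_apply, smul_eq_mul]
      linear_combination (1 : Matrix Unit Unit (RatFunc ℝ)) i j * hCc
    exact (Matrix.inv_eq_left_inv hone).symm
  · intro u v
    have hRf : ∀ k, R.filter u k =
        c * (u k - (S.C *ᵥ R.state (fun j _ => u j) k) ()) := by
      intro k
      have h1 : R.C = -c • S.C := rfl
      have h2 : R.D = c • 1 := rfl
      simp only [filter, output, h1, h2, Matrix.smul_mulVec, Matrix.one_mulVec, Pi.add_apply,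
        Pi.smul_apply, smul_eq_mul]
      ring
    have hSf : ∀ k, S.filter v k =
        (S.C *ᵥ S.state (fun j _ => v j) k) () + S.D () () * v k := by
      intro k
      simp [filter, output, Matrix.mulVec, dotProduct]
    have hRs : ∀ k, R.state (fun j _ => u j) (k + 1) = S.A *ᵥ R.state (fun j _ => u j) k +
        S.B *ᵥ fun _ => R.filter u k := by
      intro k
      have : (fun _ : Unit => R.filter u k) =
          c • ((fun _ : Unit => u k) - S.C *ᵥ R.state (fun j _ => u j) k) := by
        ext
        rw [hRf]; rfl
      rw [this]
      change (S.A - c • (S.B * S.C)) *ᵥ R.state (fun j _ => u j) k +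
        (c • S.B) *ᵥ (fun _ => u k) = _
      rw [Matrix.sub_mulVec, Matrix.smul_mulVec, Matrix.smul_mulVec, Matrix.mulVec_smul,
        Matrix.mulVec_sub, Matrix.mulVec_mulVec, smul_sub]
      abel
    constructor
    · intro h
      have hk : ∀ k, R.state (fun j _ => u j) k = S.state (fun j _ => v j) k →
          R.filter u k = v k := by
        intro k hk
        rw [hRf, hk, ← h, Pi.add_apply, hSf]
        linear_combination v k * hc1
      -- With v substituted for its output, `R` runs the same state recursion as `S` driven by v, so
      -- the trajectories coincide.
      have hst : ∀ k, R.state (fun j _ => u j) k = S.state (fun j _ => v j) k := by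
        intro k
        induction k with
        | zero => rfl
        | succ k ih => rw [hRs, hk k ih, ih]; rfl
      exact funext fun k => (hk k (hst k)).symm
    · intro h
      have hst : ∀ k, R.state (fun j _ => u j) k = S.state (fun j _ => v j) k := by
        intro k
        induction k with
        | zero => rfl
        | succ k ih => rw [hRs, ← h, ih]; rfl
      ext k
      have hv := hRf k
      rw [← h, hst] at hv
      rw [Pi.add_apply, hSf]
      linear_combination (1 + S.D () ()) * hv +
        (u k - (S.C *ᵥ S.state (fun j _ => v j) k) ()) * hc1

theorem state_add (S : DTSystem ι κ) (u v : ℕ → ι → ℝ) (k : ℕ) :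
    S.state (u + v) k = S.state u k + S.state v k := by
  induction k with
  | zero => simp [state]
  | succ k ih =>
    simp only [state, ih, Pi.add_apply, Matrix.mulVec_add]
    abel

theorem output_add (S : DTSystem ι κ) (u v : ℕ → ι → ℝ) :
    S.output (u + v) = S.output u + S.output v := by
  ext k i
  simp only [output, state_add, Pi.add_apply, Matrix.mulVec_add]
  ring

theorem filter_add (S : DTSystem Unit Unit) (u v : ℕ → ℝ) :
    S.filter (u + v) = S.filter u + S.filter v :=
  funext fun k => congrFun (congrFun (S.output_add (fun j _ => u j) (fun j _ => v j)) k) ()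

theorem filter_zero (S : DTSystem Unit Unit) : S.filter 0 = 0 := by
  have := S.filter_add 0 0
  simpa using this

/-- Continuity is for the product topology: by causality each output sample is a continuous function
of finitely many inputs, whatever the stability of the filter. -/
theorem continuous_filter (S : DTSystem Unit Unit) : Continuous S.filter := by
  have hst : ∀ k, Continuous fun v : ℕ → ℝ => S.state (fun j _ => v j) k := by
    intro k
    induction k with
    | zero => exact continuous_const
    | succ k ih =>
      refine (continuous_const.matrix_mulVec ih).add (continuous_const.matrix_mulVec ?_)
      fun_prop
  refine continuous_pi fun k => ?_
  have : Continuous fun v : ℕ → ℝ => S.output (fun j _ => v j) k := by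
    refine (continuous_const.matrix_mulVec (hst k)).add (continuous_const.matrix_mulVec ?_)
    fun_prop
  exact (continuous_apply ()).comp this

end DTSystem

/-! ### Impulse response of the analog filter -/

/-- The impulse response `C e^{As} B`. -/
def AnalogFilter.impulse (W : AnalogFilter) (s : ℝ) : ℝ :=
  W.C ⬝ᵥ (NormedSpace.exp (s • W.A) *ᵥ W.B)

theorem Matrix.continuous_exp_smul {n : Type} [Fintype n] [DecidableEq n] (A : Matrix n n ℝ) :
    Continuous fun s : ℝ => NormedSpace.exp (s • A) := by
  have h : Continuous (NormedSpace.exp : Matrix n n ℝ → Matrix n n ℝ) := by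
    open scoped Matrix.Norms.Operator in
    exact NormedSpace.exp_continuous
  exact h.comp (continuous_id.smul continuous_const)

theorem AnalogFilter.continuous_impulse (W : AnalogFilter) : Continuous W.impulse :=
  continuous_const.dotProduct ((Matrix.continuous_exp_smul W.A).matrix_mulVec continuous_const)

theorem AnalogFilter.response_of_nonneg (W : AnalogFilter) (w : ℝ → ℝ) {t : ℝ} (ht : 0 ≤ t) :
    W.response w t = ∫ τ in (0 : ℝ)..t, W.impulse (t - τ) * w τ := if_pos ht

/-! ### Zero-order hold, cell averages and their energies -/

section Hold

variable {δ : ℝ}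

theorem hold_eq (hδ : 0 < δ) (v : ℕ → ℝ) (l : ℕ) {t : ℝ}
    (ht : t ∈ Set.Ico (l * δ) ((l + 1 : ℕ) * δ)) : hold δ v t = v l := by
  have h0 : 0 ≤ t := le_trans (by positivity) ht.1
  rw [hold, if_pos h0]
  congr 1
  rw [Nat.floor_eq_iff (by positivity), le_div_iff₀ hδ, div_lt_iff₀ hδ]
  exact ⟨ht.1, by simpa using ht.2⟩

theorem hold_mul_period (hδ : 0 < δ) (v : ℕ → ℝ) (k : ℕ) : hold δ v (k * δ) = v k := by
  refine hold_eq hδ v k ⟨le_rfl, ?_⟩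
  push_cast
  nlinarith

theorem mul_le_succ_mul (hδ : 0 < δ) (l : ℕ) : (l : ℝ) * δ ≤ (l + 1 : ℕ) * δ := by
  push_cast
  nlinarith

theorem measurable_hold (δ : ℝ) (v : ℕ → ℝ) : Measurable (hold δ v) := by
  refine Measurable.ite measurableSet_Ici ?_ measurable_const
  exact (measurable_from_nat (f := v)).comp (Nat.measurable_floor.comp (measurable_id.div_const δ))

theorem setLIntegral_Ici_eq_tsum (hδ : 0 < δ) (F : ℝ → ℝ≥0∞) :
    ∫⁻ t in Set.Ici 0, F t =
      ∑' l : ℕ, ∫⁻ t in Set.Ico (l * δ) ((l + 1 : ℕ) * δ), F t := by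
  have hU : Set.Ici (0 : ℝ) = ⋃ l : ℕ, Set.Ico (l * δ) ((l + 1 : ℕ) * δ) := by
    ext t
    simp only [Set.mem_Ici, Set.mem_iUnion, Set.mem_Ico]
    constructor
    · intro ht
      refine ⟨⌊t / δ⌋₊, ?_, ?_⟩
      · rw [← le_div_iff₀ hδ]
        exact Nat.floor_le (by positivity)
      · rw [← div_lt_iff₀ hδ]
        push_cast
        exact Nat.lt_floor_add_one _
    · rintro ⟨l, hl, -⟩
      exact le_trans (by positivity) hl
  rw [hU, lintegral_iUnion (fun _ => measurableSet_Ico)]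
  exact (Monotone.pairwise_disjoint_on_Ico_succ
    (f := fun l : ℕ => (l : ℝ) * δ) (monotone_nat_of_le_succ fun l => mul_le_succ_mul hδ l))

theorem energyCT_eq (w : ℝ → ℝ) : energyCT w = ∫⁻ t in Set.Ici 0, ‖w t‖ₑ ^ 2 := by
  have := eLpNorm_nnreal_pow_eq_lintegral (f := w) (μ := volume.restrict (Set.Ici (0 : ℝ)))
    (p := 2) two_ne_zero
  simpa [energyCT] using this

theorem energyCT_hold (hδ : 0 < δ) (v : ℕ → ℝ) :
    energyCT (hold δ v) = ENNReal.ofReal δ * energy v := by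
  rw [energyCT_eq, setLIntegral_Ici_eq_tsum hδ, energy, ← ENNReal.tsum_mul_left]
  congr 1
  ext l
  rw [setLIntegral_congr_fun (g := fun _ => ‖v l‖ₑ ^ 2) measurableSet_Ico
    (fun t ht => by simp only [hold_eq hδ v l ht])]
  rw [setLIntegral_const, Real.volume_Ico, mul_comm]
  congr 2
  push_cast
  ring

theorem isL2_hold (hδ : 0 < δ) {v : ℕ → ℝ} (hv : energy v ≠ ∞) : IsL2 (hold δ v) := by
  refine ⟨(measurable_hold δ v).aestronglyMeasurable, lt_top_iff_ne_top.2 fun h => ?_⟩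
  have := energyCT_hold hδ v
  rw [energyCT, h] at this
  exact ENNReal.mul_ne_top ENNReal.ofReal_ne_top hv (by rw [← this]; simp)

theorem intervalIntegrable_mul_hold (hδ : 0 < δ) {f : ℝ → ℝ} (hf : Continuous f) (v : ℕ → ℝ)
    (l : ℕ) : IntervalIntegrable (fun τ => f τ * hold δ v τ) volume (l * δ) ((l + 1 : ℕ) * δ) := by
  -- Only the open cell is used: at its right endpoint the hold has already jumped to the next
  -- value.
  refine IntervalIntegrable.congr_uIoo (f := fun τ => f τ * v l)
    ((hf.mul continuous_const).intervalIntegrable _ _) (fun τ hτ => ?_)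
  rw [Set.uIoo_of_le (mul_le_succ_mul hδ l)] at hτ
  simp only [hold_eq hδ v l (Set.Ioo_subset_Ico_self hτ)]

theorem integral_mul_hold (hδ : 0 < δ) {f : ℝ → ℝ} (hf : Continuous f) (v : ℕ → ℝ) (n : ℕ) :
    ∫ τ in (0 : ℝ)..n * δ, f τ * hold δ v τ =
      ∑ l ∈ Finset.range n, v l * ∫ τ in (l * δ : ℝ)..(l + 1 : ℕ) * δ, f τ := by
  have := intervalIntegral.sum_integral_adjacent_intervals (μ := volume)
    (a := fun l : ℕ => (l : ℝ) * δ) (n := n) (f := fun τ => f τ * hold δ v τ)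
    (fun l _ => intervalIntegrable_mul_hold hδ hf v l)
  simp only [Nat.cast_zero, zero_mul] at this
  rw [← this]
  refine Finset.sum_congr rfl fun l _ => ?_
  rw [intervalIntegral.integral_congr_Ioo_of_le (g := fun τ => f τ * v l) (mul_le_succ_mul hδ l)
    (fun τ hτ => by simp only [hold_eq hδ v l (Set.Ioo_subset_Ico_self hτ)]),
    intervalIntegral.integral_mul_const, mul_comm]

/-- The averages of a signal over consecutive intervals of length `δ`. -/
def cellAverage (δ : ℝ) (w : ℝ → ℝ) (l : ℕ) : ℝ := δ⁻¹ * ∫ τ in (l * δ : ℝ)..(l + 1 : ℕ) * δ, w τ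

/-- Cauchy–Schwarz against the constant function 1. -/
theorem sq_lintegral_le {α : Type*} [MeasurableSpace α] (μ : Measure α) {f : α → ℝ≥0∞}
    (hf : AEMeasurable f μ) : (∫⁻ a, f a ∂μ) ^ 2 ≤ (∫⁻ a, f a ^ 2 ∂μ) * μ Set.univ := by
  have h := ENNReal.lintegral_mul_le_Lp_mul_Lq μ Real.HolderConjugate.two_two hf
    (aemeasurable_const (b := (1 : ℝ≥0∞)))
  calc (∫⁻ a, f a ∂μ) ^ 2 ≤
      ((∫⁻ a, f a ^ (2 : ℝ) ∂μ) ^ (1 / 2 : ℝ) * (∫⁻ a, 1 ^ (2 : ℝ) ∂μ) ^ (1 / 2 : ℝ)) ^ 2 := by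
        gcongr
        simpa using h
    _ = _ := by
        rw [mul_pow, ← ENNReal.rpow_natCast, ← ENNReal.rpow_natCast, ← ENNReal.rpow_mul,
          ← ENNReal.rpow_mul]
        simp

theorem enorm_cellAverage_sq_le (hδ : 0 < δ) {w : ℝ → ℝ} (hw : IsL2 w) (l : ℕ) :
    ENNReal.ofReal δ * ‖cellAverage δ w l‖ₑ ^ 2 ≤
      ∫⁻ t in Set.Ico (l * δ) ((l + 1 : ℕ) * δ), ‖w t‖ₑ ^ 2 := by
  have hsub : Set.Ico (l * δ) ((l + 1 : ℕ) * δ) ⊆ Set.Ici (0 : ℝ) :=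
    fun t ht => le_trans (by positivity) ht.1
  have hm : AEMeasurable (fun t => ‖w t‖ₑ)
      (volume.restrict (Set.Ico (l * δ) ((l + 1 : ℕ) * δ))) :=
    (hw.1.mono_measure (Measure.restrict_mono hsub le_rfl)).enorm
  have h1 := sq_lintegral_le _ hm
  have h2 : ‖∫ τ in (l * δ : ℝ)..(l + 1 : ℕ) * δ, w τ‖ₑ ≤
      ∫⁻ t in Set.Ico (l * δ) ((l + 1 : ℕ) * δ), ‖w t‖ₑ := by
    rw [intervalIntegral.integral_of_le (mul_le_succ_mul hδ l), ← integral_Ico_eq_integral_Ioc]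
    exact enorm_integral_le_lintegral_enorm _
  have h3 : ((l + 1 : ℕ) * δ - l * δ) = δ := by push_cast; ring
  rw [Measure.restrict_apply_univ, Real.volume_Ico, h3] at h1
  have hδ0 : ENNReal.ofReal δ ≠ 0 := by simpa using hδ
  have h4 : ‖δ⁻¹‖ₑ = (ENNReal.ofReal δ)⁻¹ := by
    rw [Real.enorm_of_nonneg (by positivity), ENNReal.ofReal_inv_of_pos hδ]
  set I := ∫⁻ t in Set.Ico (l * δ) ((l + 1 : ℕ) * δ), ‖w t‖ₑ ^ 2
  calc ENNReal.ofReal δ * ‖cellAverage δ w l‖ₑ ^ 2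
      ≤ ENNReal.ofReal δ * ((ENNReal.ofReal δ)⁻¹ ^ 2 * (I * ENNReal.ofReal δ)) := by
        rw [cellAverage, enorm_mul, mul_pow, h4]
        gcongr
        exact le_trans (by gcongr) h1
    _ = (ENNReal.ofReal δ * (ENNReal.ofReal δ)⁻¹) ^ 2 * I := by ring
    _ = I := by rw [ENNReal.mul_inv_cancel hδ0 ENNReal.ofReal_ne_top, one_pow, one_mul]

theorem energy_cellAverage_le (hδ : 0 < δ) {w : ℝ → ℝ} (hw : IsL2 w) :
    ENNReal.ofReal δ * energy (cellAverage δ w) ≤ energyCT w := by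
  rw [energyCT_eq, setLIntegral_Ici_eq_tsum hδ, energy, ← ENNReal.tsum_mul_left]
  exact ENNReal.tsum_le_tsum fun l => enorm_cellAverage_sq_le hδ hw l

theorem IsL2.intervalIntegrable {w : ℝ → ℝ} (hw : IsL2 w) {a b : ℝ} (ha : 0 ≤ a) (hab : a ≤ b) :
    IntervalIntegrable w volume a b := by
  rw [intervalIntegrable_iff_integrableOn_Ioc_of_le hab]
  have hsub : Set.Ioc a b ⊆ Set.Ici (0 : ℝ) := fun t ht => ha.trans ht.1.le
  have : MemLp w 2 (volume.restrict (Set.Ioc a b)) :=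
    hw.mono_measure (Measure.restrict_mono hsub le_rfl)
  exact this.integrable (by norm_num)

/-- Averaging `w` on a cell has the same effect on the integral as averaging `f` there, so the error
is governed by the oscillation of `f` over one cell. -/
theorem abs_integral_cellAverage_sub_le (hδ : 0 < δ) {f w : ℝ → ℝ} (hf : Continuous f)
    (hw : IsL2 w) (n : ℕ) {ε : ℝ}
    (hε : ∀ x ∈ Set.Icc 0 (n * δ), ∀ y ∈ Set.Icc 0 (n * δ), |x - y| ≤ δ → |f x - f y| ≤ ε) :
    |(∫ τ in (0 : ℝ)..n * δ, f τ * hold δ (cellAverage δ w) τ) -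
        ∫ τ in (0 : ℝ)..n * δ, f τ * w τ| ≤ ε * ∫ τ in (0 : ℝ)..n * δ, |w τ| := by
  have hle := mul_le_succ_mul hδ
  have hwi : ∀ l : ℕ, IntervalIntegrable w volume (l * δ) ((l + 1 : ℕ) * δ) :=
    fun l => hw.intervalIntegrable (by positivity) (hle l)
  have hfw : ∀ l : ℕ, IntervalIntegrable (fun τ => f τ * w τ) volume (l * δ) ((l + 1 : ℕ) * δ) :=
    fun l => (hwi l).continuousOn_mul hf.continuousOn
  have e1 := intervalIntegral.sum_integral_adjacent_intervals (n := n)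
    (a := fun l : ℕ => (l : ℝ) * δ) fun l _ => hfw l
  have e2 := intervalIntegral.sum_integral_adjacent_intervals (n := n)
    (a := fun l : ℕ => (l : ℝ) * δ) fun l _ => (hwi l).abs
  simp only [Nat.cast_zero, zero_mul] at e1 e2
  rw [integral_mul_hold hδ hf, ← e1, ← e2, ← Finset.sum_sub_distrib, Finset.mul_sum]
  refine (Finset.abs_sum_le_sum_abs _ _).trans (Finset.sum_le_sum fun l hl => ?_)
  have hln : ((l + 1 : ℕ) : ℝ) ≤ n := by exact_mod_cast Finset.mem_range.1 hl
  have hlen : ((l + 1 : ℕ) * δ - l * δ) = δ := by push_cast; ring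
  have hmem : ∀ x ∈ Set.Icc (l * δ) ((l + 1 : ℕ) * δ), x ∈ Set.Icc (0 : ℝ) (n * δ) :=
    fun x hx => ⟨le_trans (by positivity) hx.1, hx.2.trans (by gcongr)⟩
  set F : ℝ := δ⁻¹ * ∫ τ in (l * δ : ℝ)..(l + 1 : ℕ) * δ, f τ with hF
  have hFf : ∀ τ ∈ Set.Ioc (l * δ) ((l + 1 : ℕ) * δ), |F - f τ| ≤ ε := by
    intro τ hτ
    have h1 : F - f τ = δ⁻¹ * ∫ s in (l * δ : ℝ)..(l + 1 : ℕ) * δ, (f s - f τ) := by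
      rw [intervalIntegral.integral_sub (hf.intervalIntegrable _ _) (by simp),
        intervalIntegral.integral_const, hlen, mul_sub, smul_eq_mul, inv_mul_cancel_left₀ hδ.ne']
    have h2 : ‖∫ s in (l * δ : ℝ)..(l + 1 : ℕ) * δ, (f s - f τ)‖ ≤
        ε * |(l + 1 : ℕ) * δ - l * δ| := by
      refine intervalIntegral.norm_integral_le_of_norm_le_const fun s hs => ?_
      rw [Set.uIoc_of_le (hle l)] at hs
      refine hε s (hmem s (Set.Ioc_subset_Icc_self hs)) τ (hmem τ (Set.Ioc_subset_Icc_self hτ)) ?_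
      rw [abs_le]
      constructor <;> linarith [hs.1, hs.2, hτ.1, hτ.2]
    rw [hlen, abs_of_pos hδ] at h2
    rw [h1, abs_mul, abs_of_pos (inv_pos.2 hδ), inv_mul_le_iff₀ hδ, mul_comm δ ε]
    exact h2
  -- The average moves from `w` to `f`: both products equal δ⁻¹ ∫f ∫w.
  have h3 : (cellAverage δ w l * ∫ τ in (l * δ : ℝ)..(l + 1 : ℕ) * δ, f τ) -
      ∫ τ in (l * δ : ℝ)..(l + 1 : ℕ) * δ, f τ * w τ =
      ∫ τ in (l * δ : ℝ)..(l + 1 : ℕ) * δ, (F - f τ) * w τ := by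
    simp only [sub_mul]
    rw [intervalIntegral.integral_sub ((hwi l).const_mul F) (hfw l),
      intervalIntegral.integral_const_mul, hF, cellAverage]
    ring
  rw [h3, ← intervalIntegral.integral_const_mul]
  refine intervalIntegral.norm_integral_le_of_norm_le (g := fun τ => ε * |w τ|)
    (f := fun τ => (F - f τ) * w τ) (hle l) (ae_of_all _ fun τ hτ => ?_)
    ((hwi l).abs.const_mul ε)
  rw [norm_mul]
  exact mul_le_mul_of_nonneg_right (hFf τ hτ) (norm_nonneg _)

end Hold

/-- For every N ≥ 1 the instant kh is the grid point of index kN, so the cell estimate applies on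
all of [0, kh], with the oscillation of the impulse response tending to zero. -/
theorem AnalogFilter.tendsto_response_cellAverage (W : AnalogFilter) {h : ℝ} (hh : 0 < h)
    {w : ℝ → ℝ} (hw : IsL2 w) (k : ℕ) :
    Tendsto (fun N : ℕ => W.response (hold (h / N) (cellAverage (h / N) w)) (k * h)) atTop
      (𝓝 (W.response w (k * h))) := by
  have ht : (0 : ℝ) ≤ k * h := by positivity
  set f : ℝ → ℝ := fun τ => W.impulse (k * h - τ)
  have hf : Continuous f := W.continuous_impulse.comp (continuous_const.sub continuous_id)
  rw [Metric.tendsto_atTop]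
  intro ε hε
  set I := ∫ τ in (0 : ℝ)..k * h, |w τ|
  have hI : 0 ≤ I := intervalIntegral.integral_nonneg ht fun _ _ => abs_nonneg _
  have huc := isCompact_Icc.uniformContinuousOn_of_continuous
    (hf.continuousOn (s := Set.Icc 0 (k * h)))
  rw [Metric.uniformContinuousOn_iff] at huc
  -- The tolerance uses I + 1 because I vanishes when w = 0 almost everywhere on [0, kh].
  obtain ⟨η, hη, hηf⟩ := huc (ε / (I + 1)) (by positivity)
  obtain ⟨N₀, hN₀⟩ := exists_nat_gt (h / η)
  refine ⟨max N₀ 1, fun N hN => ?_⟩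
  have hN1 : (0 : ℝ) < N := by exact_mod_cast (le_max_right _ _).trans hN
  have hNN : h / η < N := hN₀.trans_le (by exact_mod_cast (le_max_left _ _).trans hN)
  have hδ : 0 < h / N := by positivity
  have hδη : h / N < η := by
    rw [div_lt_iff₀ hη] at hNN
    rw [div_lt_iff₀ hN1]; linarith
  have hT : ((k * N : ℕ) : ℝ) * (h / N) = k * h := by
    push_cast; field_simp
  have key := abs_integral_cellAverage_sub_le hδ hf hw (k * N) (ε := ε / (I + 1)) (by
    intro x hx y hy hxy
    rw [hT] at hx hy
    exact (hηf x hx y hy (lt_of_le_of_lt hxy hδη)).le)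
  rw [hT] at key
  rw [W.response_of_nonneg _ ht, W.response_of_nonneg _ ht, Real.dist_eq]
  refine key.trans_lt ?_
  change ε / (I + 1) * I < ε
  rw [div_mul_eq_mul_div, div_lt_iff₀ (by positivity)]
  nlinarith

/-! ### Discrete-time lifting and sequence energies -/

theorem idlift_mul_add {N : ℕ} (V : ℕ → Fin N → ℝ) (k : ℕ) (i : Fin N) :
    idlift N V (k * N + i) = V k i := by
  have hN : 0 < N := i.pos
  have h1 : (k * N + i) / N = k := by
    rw [Nat.add_comm, Nat.add_mul_div_right _ _ hN, Nat.div_eq_of_lt i.2, Nat.zero_add]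
  have h2 : (k * N + i) % N = i := Nat.mul_add_mod_of_lt i.2
  simp only [idlift, dif_pos hN, h1, h2]

theorem idlift_dlift {N : ℕ} (hN : 0 < N) (v : ℕ → ℝ) : idlift N (dlift N v) = v := by
  ext j
  simp only [idlift, dif_pos hN, dlift, Nat.div_add_mod']

theorem energy_idlift {N : ℕ} (hN : 0 < N) (V : ℕ → Fin N → ℝ) :
    energy (idlift N V) = energyVec V := by
  have : NeZero N := ⟨hN.ne'⟩
  rw [energy, ← (Nat.divModEquiv N).symm.tsum_eq, ENNReal.tsum_prod', energyVec]
  refine tsum_congr fun k => ?_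
  rw [tsum_fintype]
  refine Finset.sum_congr rfl fun i _ => ?_
  rw [← idlift_mul_add V k i]
  rfl

theorem energy_eq_zero {v : ℕ → ℝ} (hv : energy v = 0) : v = 0 := by
  ext k
  have := ENNReal.tsum_eq_zero.1 hv k
  simpa using this

theorem IsEll2.energy_ne_top {v : ℕ → ℝ} (hv : IsEll2 v) : energy v ≠ ∞ := by
  have h : Summable fun k => ‖v k‖ ^ 2 := by
    have := Memℓp.summable (p := 2) (by norm_num) hv
    simpa using this
  have e : energy v = ∑' k, ENNReal.ofReal (‖v k‖ ^ 2) := by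
    refine tsum_congr fun k => ?_
    rw [ENNReal.ofReal_pow (norm_nonneg _), ofReal_norm]
  rw [e, ← ENNReal.ofReal_tsum_of_nonneg (fun _ => by positivity) h]
  exact ENNReal.ofReal_ne_top

theorem energy_neg (v : ℕ → ℝ) : energy (-v) = energy v := by simp [energy]

namespace DTSystem

/-- Variation of constants over a block of n steps; with j = 0 it also gives the convolution
formula. -/
theorem state_add_steps {ι κ : Type} [Fintype ι] (S : DTSystem ι κ) (u : ℕ → ι → ℝ) (j n : ℕ) :
    S.state u (j + n) = S.A ^ n *ᵥ S.state u j +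
      ∑ l ∈ Finset.range n, S.A ^ (n - 1 - l) *ᵥ (S.B *ᵥ u (j + l)) := by
  induction n with
  | zero => simp
  | succ n ih =>
    rw [← Nat.add_assoc]
    change S.A *ᵥ S.state u (j + n) + S.B *ᵥ u (j + n) = _
    rw [ih, Finset.sum_range_succ, Matrix.mulVec_add, Matrix.mulVec_mulVec, ← pow_succ',
      Matrix.mulVec_sum, add_assoc]
    congr 2
    · refine Finset.sum_congr rfl fun l hl => ?_
      have hl' := Finset.mem_range.1 hl
      rw [Matrix.mulVec_mulVec, ← pow_succ']
      congr 2
      omega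
    · simp

/-- The discrete-time lifting of a scalar system. -/
def lifted (S : DTSystem Unit Unit) (N : ℕ) : DTSystem (Fin N) (Fin N) where
  dim := S.dim
  A := S.A ^ N
  B := Matrix.of fun i l => (S.A ^ (N - 1 - l) * S.B) i ()
  C := Matrix.of fun i j => (S.C * S.A ^ (i : ℕ)) () j
  D := Matrix.of (fun i l : Fin N => if (l : ℕ) < i then
    (S.C * S.A ^ (i - 1 - l : ℕ) * S.B) () () else 0) + S.D () () • (1 : Matrix (Fin N) (Fin N) ℝ)

theorem lifted_state (S : DTSystem Unit Unit) (N : ℕ) (V : ℕ → Fin N → ℝ) (k : ℕ) :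
    ((S.lifted N).state V k : Fin S.dim → ℝ) = S.state (fun j _ => idlift N V j) (k * N) := by
  induction k with
  | zero => rw [Nat.zero_mul]; rfl
  | succ k ih =>
    have hs := S.state_add_steps (fun j _ => idlift N V j) (k * N) N
    rw [Nat.succ_mul]
    refine Eq.trans ?_ hs.symm
    rw [← ih]
    refine congrArg (S.A ^ N *ᵥ (S.lifted N).state V k + ·)
      (?_ : (Matrix.of fun i (l : Fin N) => (S.A ^ (N - 1 - l) * S.B) i ()) *ᵥ V k = _)
    rw [Finset.sum_range]
    ext i
    simp only [Matrix.mulVec, dotProduct, Matrix.of_apply, Finset.sum_apply]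
    refine Finset.sum_congr rfl fun l _ => ?_
    rw [idlift_mul_add, Matrix.mul_apply, Finset.sum_mul]
    simp [mul_assoc]

theorem lifted_output (S : DTSystem Unit Unit) (N : ℕ) (V : ℕ → Fin N → ℝ) :
    (S.lifted N).output V = dlift N (S.filter (idlift N V)) := by
  ext k i
  simp only [dlift, filter, output, lifted_state, state_add_steps, idlift_mul_add]
  rw [Matrix.mulVec_add, Matrix.mulVec_mulVec, Matrix.mulVec_sum]
  simp only [lifted, Matrix.add_mulVec, Pi.add_apply, Matrix.smul_mulVec, Matrix.one_mulVec,
    Pi.smul_apply, Finset.sum_apply, Matrix.mulVec_mulVec]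
  have h1 : (S.D *ᵥ fun _ => V k i) () = S.D () () • V k i := by
    simp [Matrix.mulVec, dotProduct]
  rw [h1, ← add_assoc]
  congr 2
  -- Extending the summand by zero to all naturals allows the sum over `Fin N` to be cut down to l <
  -- i.
  let g : ℕ → ℝ := fun l => if l < i then
    (S.C * S.A ^ (i - 1 - l : ℕ) * S.B) () () * idlift N V (k * N + l) else 0
  have h2 : ((Matrix.of fun i l : Fin N => if (l : ℕ) < i then
      (S.C * S.A ^ (i - 1 - l : ℕ) * S.B) () () else 0) *ᵥ V k) i = ∑ l : Fin N, g l := by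
    simp only [Matrix.mulVec, dotProduct, Matrix.of_apply, g, ite_mul, zero_mul, idlift_mul_add]
  rw [h2, ← Finset.sum_range, ← Finset.sum_subset (Finset.range_subset_range.2 i.2.le)]
  · refine Finset.sum_congr rfl fun l hl => ?_
    simp only [g, if_pos (Finset.mem_range.1 hl)]
    simp [Matrix.mulVec, dotProduct, Matrix.mul_assoc]
  · intro l _ hl
    simp only [Finset.mem_range] at hl
    simp [g, hl]

end DTSystem

/-! ### Exact discretization of the analog filter under a hold -/

namespace AnalogFilter

/-- The step-invariant discretization of an analog filter with sampling period `δ`. -/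
def discretize (W : AnalogFilter) (δ : ℝ) : DTSystem Unit Unit where
  dim := W.dim
  A := NormedSpace.exp (δ • W.A)
  B := Matrix.of fun i _ => ∫ s in (0 : ℝ)..δ, (NormedSpace.exp ((δ - s) • W.A) *ᵥ W.B) i
  C := Matrix.of fun _ i => W.C i
  D := 0

/-- The semigroup law splits the exponential into p full periods and a remainder in the last one, so
a cell integral of the impulse response is a Markov parameter of the discretization. -/
theorem integral_impulse (W : AnalogFilter) (δ : ℝ) (l p : ℕ) :
    ∫ τ in (l * δ : ℝ)..(l + 1 : ℕ) * δ, W.impulse ((l + p + 1 : ℕ) * δ - τ) =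
      ((W.discretize δ).C * (W.discretize δ).A ^ p * (W.discretize δ).B) () () := by
  have h1 : ∀ s : ℝ, W.impulse ((l + p + 1 : ℕ) * δ - (s + l * δ)) =
      ∑ i, ((W.discretize δ).C * (W.discretize δ).A ^ p) () i *
        (NormedSpace.exp ((δ - s) • W.A) *ᵥ W.B) i := by
    intro s
    have h2 : ((l + p + 1 : ℕ) * δ - (s + l * δ)) • W.A = p • (δ • W.A) + (δ - s) • W.A := by
      rw [← Nat.cast_smul_eq_nsmul ℝ, smul_smul, ← add_smul]
      congr 1
      push_cast
      ring
    have hc : Commute (p • (δ • W.A)) ((δ - s) • W.A) :=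
      (((Commute.refl W.A).smul_left δ).smul_left p).smul_right (δ - s)
    rw [impulse, h2, Matrix.exp_add_of_commute _ _ hc, Matrix.exp_nsmul, ← Matrix.mulVec_mulVec,
      Matrix.dotProduct_mulVec]
    rfl
  have h3 := intervalIntegral.integral_comp_add_right (a := 0) (b := δ)
    (fun τ => W.impulse ((l + p + 1 : ℕ) * δ - τ)) (l * δ)
  have h4 : δ + l * δ = (l + 1 : ℕ) * δ := by push_cast; ring
  rw [zero_add, h4] at h3
  rw [← h3, Matrix.mul_apply]
  simp only [h1]
  rw [intervalIntegral.integral_finsetSum]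
  · refine Finset.sum_congr rfl fun i _ => ?_
    rw [intervalIntegral.integral_const_mul]
    rfl
  · intro i _
    refine Continuous.intervalIntegrable (continuous_const.mul ?_) _ _
    refine (continuous_apply i).comp (Continuous.matrix_mulVec ?_ continuous_const)
    exact (Matrix.continuous_exp_smul W.A).comp (continuous_const.sub continuous_id)

theorem response_hold (W : AnalogFilter) {δ : ℝ} (hδ : 0 < δ) (v : ℕ → ℝ) :
    sampler δ (W.response (hold δ v)) = (W.discretize δ).filter v := by
  ext j
  rw [sampler, W.response_of_nonneg _ (by positivity),
    integral_mul_hold hδ (f := fun τ => W.impulse (j * δ - τ))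
      (W.continuous_impulse.comp (continuous_const.sub continuous_id))]
  have hs := (W.discretize δ).state_add_steps (fun j _ => v j) 0 j
  simp only [Nat.zero_add] at hs
  have hD : (W.discretize δ).D = 0 := rfl
  have h0 : (W.discretize δ).state (fun j _ => v j) 0 = 0 := rfl
  rw [DTSystem.filter, DTSystem.output, hs, hD, h0, Matrix.mulVec_zero, Matrix.zero_mulVec, zero_add,
    add_zero, Matrix.mulVec_sum, Finset.sum_apply]
  refine Finset.sum_congr rfl fun l hl => ?_
  obtain ⟨p, rfl⟩ := Nat.exists_eq_add_of_lt (Finset.mem_range.1 hl)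
  rw [W.integral_impulse, Matrix.mulVec_mulVec, Matrix.mulVec_mulVec]
  have : l + p + 1 - 1 - l = p := by omega
  rw [this]
  simp [Matrix.mulVec, dotProduct, mul_comm]

theorem lifted_discretize_output (W : AnalogFilter) {h : ℝ} (hh : 0 < h) {N : ℕ} (hN : 0 < N)
    (V : ℕ → Fin N → ℝ) :
    ((W.discretize (h / N)).lifted N).output V = fastLifted W h N V := by
  have hN' : (0 : ℝ) < N := by exact_mod_cast hN
  rw [DTSystem.lifted_output, ← W.response_hold (by positivity)]
  rfl

theorem fastLifted_first (W : AnalogFilter) (h : ℝ) {N : ℕ} (hN : 0 < N)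
    (V : ℕ → Fin N → ℝ) (k : ℕ) :
    fastLifted W h N V k ⟨0, hN⟩ = sampler h (W.response (hold (h / N) (idlift N V))) k := by
  have hN' : (N : ℝ) ≠ 0 := by exact_mod_cast hN.ne'
  simp only [fastLifted, dlift, sampler]
  congr 1
  push_cast
  field_simp
  simp

end AnalogFilter

/-! ### Convergence of gains -/

theorem AnalogFilter.response_zero (W : AnalogFilter) : W.response 0 = 0 := by
  ext t; simp [AnalogFilter.response]

/-- Gains of a causal sampled-data system are limits of the gains over piecewise constant inputs:
`out y x` is the output caused by the sampled analog signal `y` and the discrete input `x`, whose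
energy is `c x`. -/
theorem tendsto_gain {X : Type} (W : AnalogFilter) {h : ℝ} (hh : 0 < h)
    (out : (ℕ → ℝ) → X → ℕ → ℝ) (c : X → ℝ≥0∞) (adm : X → Prop)
    (hc : ∀ x, adm x → c x ≠ ∞) (hcont : ∀ x, Continuous fun y => out y x)
    (hzero : ∀ x, c x = 0 → out 0 x = 0) :
    Tendsto (fun N : ℕ => ⨆ (V : ℕ → Fin N → ℝ) (x : X) (_ : energyVec V ≠ ∞) (_ : adm x)
        (_ : energyVec V + c x ≠ 0),
        energy (out (sampler h (W.response (hold (h / N) (idlift N V)))) x) /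
          (ENNReal.ofReal (h / N) * energyVec V + c x)) atTop
      (𝓝 (⨆ (w : ℝ → ℝ) (x : X) (_ : IsL2 w) (_ : adm x) (_ : energyCT w + c x ≠ 0),
        energy (out (sampler h (W.response w)) x) / (energyCT w + c x))) := by
  rw [tendsto_order]
  constructor
  · intro a ha
    simp only [lt_iSup_iff] at ha
    obtain ⟨w, x, hw, hx, hE, ha⟩ := ha
    have hEt : energyCT w + c x ≠ ∞ :=
      ENNReal.add_ne_top.2 ⟨ENNReal.pow_ne_top hw.2.ne, hc x hx⟩
    -- A strict lower bound for the gain is already attained by finitely many error samples.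
    rw [ENNReal.lt_div_iff_mul_lt (Or.inl hE) (Or.inl hEt), energy, ENNReal.tsum_eq_iSup_nat,
      lt_iSup_iff] at ha
    obtain ⟨M, hM⟩ := ha
    have hy : Tendsto (fun N : ℕ =>
        sampler h (W.response (hold (h / N) (cellAverage (h / N) w)))) atTop
        (𝓝 (sampler h (W.response w))) :=
      tendsto_pi_nhds.2 fun k => W.tendsto_response_cellAverage hh hw k
    have hsum : Tendsto (fun N : ℕ => ∑ k ∈ Finset.range M,
        ‖out (sampler h (W.response (hold (h / N) (cellAverage (h / N) w)))) x k‖ₑ ^ 2) atTop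
        (𝓝 (∑ k ∈ Finset.range M, ‖out (sampler h (W.response w)) x k‖ₑ ^ 2)) := by
      refine tendsto_finsetSum _ fun k _ => ?_
      have hk := tendsto_pi_nhds.1 (((hcont x).tendsto _).comp hy) k
      exact ((ENNReal.continuous_pow 2).tendsto _).comp ((continuous_enorm.tendsto _).comp hk)
    filter_upwards [hsum.eventually (lt_mem_nhds hM), eventually_ge_atTop 1] with N hN hN1
    have hN0 : 0 < N := hN1
    have hδ : 0 < h / N := by
      have : (0 : ℝ) < N := by exact_mod_cast hN0
      positivity
    set V := dlift N (cellAverage (h / N) w)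
    have hidV : idlift N V = cellAverage (h / N) w := idlift_dlift hN0 _
    rw [← hidV] at hN
    have hNe : a * (energyCT w + c x) <
        energy (out (sampler h (W.response (hold (h / N) (idlift N V)))) x) :=
      hN.trans_le (ENNReal.sum_le_tsum _)
    have hVle : ENNReal.ofReal (h / N) * energyVec V ≤ energyCT w := by
      rw [← energy_idlift hN0, hidV]
      exact energy_cellAverage_le hδ hw
    have hVt : energyVec V ≠ ∞ := by
      intro ht
      rw [ht, ENNReal.mul_top (by simpa using hδ)] at hVle
      exact ENNReal.pow_ne_top hw.2.ne (top_le_iff.1 hVle)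
    -- A zero total input would give zero output, contradicting the strict bound `hNe`.
    have hV0 : energyVec V + c x ≠ 0 := by
      intro h0
      rw [add_eq_zero] at h0
      have h1 : idlift N V = 0 := energy_eq_zero (by rw [energy_idlift hN0, h0.1])
      have h2 : hold (h / N) (0 : ℕ → ℝ) = 0 := by ext; simp [hold]
      have h3 : sampler h 0 = 0 := rfl
      rw [h1, h2, W.response_zero, h3, hzero x h0.2] at hNe
      simp [energy] at hNe
    simp only [lt_iSup_iff]
    refine ⟨V, x, hVt, hx, hV0, ?_⟩
    calc a < energy (out (sampler h (W.response (hold (h / N) (idlift N V)))) x) /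
          (energyCT w + c x) := by
          rwa [ENNReal.lt_div_iff_mul_lt (Or.inl hE) (Or.inl hEt)]
      -- Averaging has not increased the energy, so the denominator can only shrink.
      _ ≤ _ := by gcongr
  · intro a ha
    -- Upper bound for every N ≥ 1: the held signal is itself admissible and has the same weighted
    -- energy.
    filter_upwards [eventually_ge_atTop 1] with N hN1
    refine lt_of_le_of_lt ?_ ha
    have hN0 : 0 < N := hN1
    have hδ : 0 < h / N := by
      have : (0 : ℝ) < N := by exact_mod_cast hN0
      positivity
    refine iSup_le fun V => iSup_le fun x => iSup_le fun hV => iSup_le fun hx => iSup_le fun h0 => ?_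
    have hE : energyCT (hold (h / N) (idlift N V)) = ENNReal.ofReal (h / N) * energyVec V := by
      rw [energyCT_hold hδ, energy_idlift hN0]
    rw [← hE]
    have hw : IsL2 (hold (h / N) (idlift N V)) := isL2_hold hδ (by rwa [energy_idlift hN0])
    have hne : energyCT (hold (h / N) (idlift N V)) + c x ≠ 0 := by
      rw [hE]
      intro h1
      rw [add_eq_zero, mul_eq_zero] at h1
      rcases h1 with ⟨h1 | h1, h2⟩
      · exact absurd h1 (by simpa using hδ)
      · exact h0 (by rw [h1, h2, add_zero])
    exact le_iSup_of_le _ (le_iSup_of_le x (le_iSup_of_le hw (le_iSup_of_le hx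
      (le_iSup_of_le hne le_rfl))))

/-! ### Explicit solution of the error systems -/

open DTSystem

theorem sampler_delay {h : ℝ} (hh : 0 < h) (m : ℕ) (y : ℝ → ℝ) :
    sampler h (delay (m * h) y) = shift m (sampler h y) := by
  ext k
  simp only [sampler, delay, shift]
  have hiff : (m : ℝ) * h ≤ k * h ↔ m ≤ k := by
    rw [mul_le_mul_iff_left₀ hh, Nat.cast_le]
  by_cases hmk : m ≤ k
  · rw [if_pos (hiff.2 hmk), if_pos hmk, Nat.cast_sub hmk, sub_mul]
  · rw [if_neg (fun hc => hmk (hiff.1 hc)), if_neg hmk]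

theorem continuous_shift (m : ℕ) : Continuous (shift m) := by
  refine continuous_pi fun k => ?_
  by_cases hmk : m ≤ k
  · simp only [shift, if_pos hmk]
    exact continuous_apply _
  · simp only [shift, if_neg hmk]
    exact continuous_const

section ErrorSystems

variable (K₁ K₂ Wd Wn R : DTSystem Unit Unit)

/-- The encoder error caused by the sampled analog signal `y` and the quantization input `d`,
where `R` realizes the sensitivity. -/
def encoderOut (y d : ℕ → ℝ) : ℕ → ℝ := y - K₁.filter (R.filter (y + Wd.filter d))

/-- The sampled decoder error caused by the sampled analog signal `y`, the quantization input `d`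
and the channel input `n`, where `R` realizes the sensitivity. -/
def decoderOut (m : ℕ) (y d n : ℕ → ℝ) : ℕ → ℝ :=
  K₂.filter (R.filter (y + Wd.filter d) + Wn.filter n) - shift m y

variable {K₁ K₂ Wd Wn R}

/-- Adding W_d d to both sides turns the loop into v + K₁ v = y + W_d d for v = e + W_d d, which the
sensitivity solves uniquely. -/
theorem eq_encoderOut_iff (hR : ∀ u v : ℕ → ℝ, v + K₁.filter v = u ↔ v = R.filter u)
    {y d e : ℕ → ℝ} :
    (∀ k, e k = y k - K₁.filter (e + Wd.filter d) k) ↔ e = encoderOut K₁ Wd R y d := by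
  rw [encoderOut]
  constructor
  · intro he
    have he' : e = y - K₁.filter (e + Wd.filter d) := funext he
    rw [← (hR _ (e + Wd.filter d)).1]
    · exact he'
    · nth_rewrite 1 [he']
      abel
  · intro he
    have hv := (hR (y + Wd.filter d) _).2 rfl
    have h2 : e + Wd.filter d = R.filter (y + Wd.filter d) := by
      rw [he, sub_add_eq_add_sub, sub_eq_iff_eq_add, hv]
    intro k
    rw [h2]
    exact congrFun he k

theorem encoderOut_add (hR : ∀ u v : ℕ → ℝ, v + K₁.filter v = u ↔ v = R.filter u)
    (y d : ℕ → ℝ) : encoderOut K₁ Wd R y d + Wd.filter d = R.filter (y + Wd.filter d) := by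
  have hv := (hR (y + Wd.filter d) _).2 rfl
  rw [encoderOut, sub_add_eq_add_sub, sub_eq_iff_eq_add, hv]

theorem continuous_encoderOut (d : ℕ → ℝ) : Continuous fun y => encoderOut K₁ Wd R y d :=
  continuous_id.sub (K₁.continuous_filter.comp
    (R.continuous_filter.comp (continuous_id.add continuous_const)))

theorem continuous_decoderOut (m : ℕ) (d n : ℕ → ℝ) :
    Continuous fun y => decoderOut K₂ Wd Wn R m y d n :=
  (K₂.continuous_filter.comp ((R.continuous_filter.comp
    (continuous_id.add continuous_const)).add continuous_const)).sub (continuous_shift m)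

theorem encoderOut_zero : encoderOut K₁ Wd R 0 0 = 0 := by
  simp [encoderOut, filter_zero]

theorem decoderOut_zero (m : ℕ) : decoderOut K₂ Wd Wn R m 0 0 0 = 0 := by
  ext
  simp [decoderOut, filter_zero, shift]

theorem encoderError_iff (hR : ∀ u v : ℕ → ℝ, v + K₁.filter v = u ↔ v = R.filter u)
    {h : ℝ} {W : AnalogFilter} {w : ℝ → ℝ} {d e : ℕ → ℝ} :
    EncoderError h W K₁ Wd w d e ↔ e = encoderOut K₁ Wd R (sampler h (W.response w)) d :=
  eq_encoderOut_iff hR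

theorem decoderError_iff (hR : ∀ u v : ℕ → ℝ, v + K₁.filter v = u ↔ v = R.filter u)
    {h L : ℝ} {W : AnalogFilter} {w : ℝ → ℝ} {d n : ℕ → ℝ} {er : ℝ → ℝ} :
    DecoderError h L W K₁ K₂ Wd Wn w d n er ↔ er = fun t =>
      hold h (K₂.filter (R.filter (sampler h (W.response w) + Wd.filter d) + Wn.filter n)) t -
        delay L (W.response w) t := by
  simp only [DecoderError, encoderError_iff hR, exists_eq_left, encoderOut_add hR]
  exact funext_iff.symm

theorem sampler_decoder {h : ℝ} (hh : 0 < h) (m : ℕ) (W : AnalogFilter) (w : ℝ → ℝ)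
    (d n : ℕ → ℝ) :
    sampler h (fun t => hold h (K₂.filter (R.filter (sampler h (W.response w) + Wd.filter d) +
      Wn.filter n)) t - delay (m * h) (W.response w) t) =
      decoderOut K₂ Wd Wn R m (sampler h (W.response w)) d n := by
  ext k
  rw [decoderOut, Pi.sub_apply, ← sampler_delay hh, ← hold_mul_period hh
    (K₂.filter (R.filter (sampler h (W.response w) + Wd.filter d) + Wn.filter n)) k]
  rfl

theorem encoderNorm_eq (hR : ∀ u v : ℕ → ℝ, v + K₁.filter v = u ↔ v = R.filter u)
    (h : ℝ) (W : AnalogFilter) :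
    encoderNorm h W K₁ Wd = (⨆ (w : ℝ → ℝ) (d : ℕ → ℝ) (_ : IsL2 w) (_ : IsEll2 d)
      (_ : energyCT w + energy d ≠ 0),
      energy (encoderOut K₁ Wd R (sampler h (W.response w)) d) / (energyCT w + energy d)) ^
        (1 / 2 : ℝ) := by
  rw [encoderNorm]
  congr 1
  refine iSup_congr fun w => iSup_congr fun d => le_antisymm ?_ ?_
  · refine iSup_le fun e => iSup_le fun hw => iSup_le fun hd => iSup_le fun h0 => iSup_le fun he => ?_
    rw [encoderError_iff hR] at he
    subst he
    exact le_iSup_of_le hw (le_iSup_of_le hd (le_iSup_of_le h0 le_rfl))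
  · refine iSup_le fun hw => iSup_le fun hd => iSup_le fun h0 => ?_
    exact le_iSup_of_le _ (le_iSup_of_le hw (le_iSup_of_le hd (le_iSup_of_le h0
      (le_iSup_of_le ((encoderError_iff hR).2 rfl) le_rfl))))

theorem decoderNorm_eq (hR : ∀ u v : ℕ → ℝ, v + K₁.filter v = u ↔ v = R.filter u)
    {h : ℝ} (hh : 0 < h) (m : ℕ) (W : AnalogFilter) :
    decoderNorm h (m * h) W K₁ K₂ Wd Wn = (⨆ (w : ℝ → ℝ) (x : (ℕ → ℝ) × (ℕ → ℝ)) (_ : IsL2 w)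
      (_ : IsEll2 x.1 ∧ IsEll2 x.2) (_ : energyCT w + (energy x.1 + energy x.2) ≠ 0),
      energy (decoderOut K₂ Wd Wn R m (sampler h (W.response w)) x.1 x.2) /
        (energyCT w + (energy x.1 + energy x.2))) ^ (1 / 2 : ℝ) := by
  rw [decoderNorm]
  congr 1
  refine iSup_congr fun w => le_antisymm ?_ ?_
  · refine iSup_le fun d => iSup_le fun n => iSup_le fun er => iSup_le fun hw => iSup_le fun hd =>
      iSup_le fun hn => iSup_le fun h0 => iSup_le fun he => ?_
    rw [decoderError_iff hR] at he
    subst he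
    rw [sampler_decoder hh]
    rw [add_assoc] at h0 ⊢
    exact le_iSup_of_le (d, n) (le_iSup_of_le hw (le_iSup_of_le ⟨hd, hn⟩
      (le_iSup_of_le h0 le_rfl)))
  · refine iSup_le fun x => iSup_le fun hw => iSup_le fun hx => iSup_le fun h0 => ?_
    rw [← add_assoc] at h0 ⊢
    rw [← sampler_decoder hh]
    exact le_iSup_of_le x.1 (le_iSup_of_le x.2 (le_iSup_of_le _ (le_iSup_of_le hw
      (le_iSup_of_le hx.1 (le_iSup_of_le hx.2 (le_iSup_of_le h0
        (le_iSup_of_le ((decoderError_iff hR).2 rfl) le_rfl)))))))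

end ErrorSystems

/-! ### Realizations of the approximants -/

theorem realizes_firstRow (W : AnalogFilter) {h : ℝ} (hh : 0 < h) {N : ℕ} (hN : 0 < N) :
    Realizes (firstRow N * ((W.discretize (h / N)).lifted N).transfer)
      (fun V k _ => sampler h (W.response (hold (h / N) (idlift N V))) k) := by
  let D : Matrix Unit (Fin N) ℝ := Matrix.of fun _ j => if (j : ℕ) = 0 then 1 else 0
  convert (realizes_static D).comp ((W.discretize (h / N)).lifted N).realizes using 1
  · congr 1
    ext i j
    by_cases hj : (j : ℕ) = 0 <;> simp [firstRow, D, hj]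
  · ext V k i
    rw [Function.comp_apply, W.lifted_discretize_output hh hN, ← W.fastLifted_first h hN]
    have hD : D () = Pi.single ⟨0, hN⟩ 1 := by
      ext j
      simp [D, Pi.single_apply, Fin.ext_iff]
    change _ = D () ⬝ᵥ fastLifted W h N V k
    rw [hD, single_one_dotProduct]

theorem exists_encoder_realization (W : AnalogFilter) (K₁ Wd R : DTSystem Unit Unit)
    (hRt : R.transfer = (1 + K₁.transfer)⁻¹) {h : ℝ} (hh : 0 < h) {N : ℕ} (hN : 0 < N) :
    ∃ T : DTSystem (Fin N ⊕ Unit) Unit,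
      T.transfer = lft (plant₁ ((W.discretize (h / N)).lifted N).transfer Wd) K₁.transfer ∧
      ∀ (V : ℕ → Fin N → ℝ) (d : ℕ → ℝ),
        (fun k => T.output (fun j => Sum.elim (V j) fun _ => d j) k ()) =
          encoderOut K₁ Wd R (sampler h (W.response (hold (h / N) (idlift N V)))) d := by
  have hP := realizes_firstRow W hh hN
  have h1 := (hP.fromCols (realizes_zero (ι := Unit))).add
    (((realizes_neg_one.comp K₁.realizes).comp R.realizes).comp (hP.fromCols Wd.realizes))
  obtain ⟨T, hT, hF⟩ := h1
  refine ⟨T, ?_, fun V d => ?_⟩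
  · rw [hT, hRt]
    simp only [lft, plant₁, Matrix.toBlocks_fromBlocks₁₁, Matrix.toBlocks_fromBlocks₁₂,
      Matrix.toBlocks_fromBlocks₂₁, Matrix.toBlocks_fromBlocks₂₂, Matrix.neg_mul, Matrix.one_mul,
      sub_neg_eq_add]
  · ext k
    rw [hF]
    change (sampler h (W.response (hold (h / N) (idlift N V))) k + 0) +
      -K₁.filter (R.filter (sampler h (W.response (hold (h / N) (idlift N V))) + Wd.filter d)) k = _
    rw [add_zero, ← sub_eq_add_neg]
    rfl

/-- The generalized plant encodes delayed signal minus reconstruction, the opposite sign of the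
decoder error; energies do not see the difference. -/
theorem exists_decoder_realization (W : AnalogFilter) (K₁ K₂ Wd Wn R : DTSystem Unit Unit)
    (hRt : R.transfer = (1 + K₁.transfer)⁻¹) {h : ℝ} (hh : 0 < h) (m : ℕ) {N : ℕ} (hN : 0 < N) :
    ∃ T : DTSystem (Fin N ⊕ (Unit ⊕ Unit)) Unit,
      T.transfer =
        lft (plant₂ m ((W.discretize (h / N)).lifted N).transfer K₁ Wd Wn) K₂.transfer ∧
      ∀ (V : ℕ → Fin N → ℝ) (d n : ℕ → ℝ),
        (fun k => T.output
          (fun j => Sum.elim (V j) (Sum.elim (fun _ => d j) fun _ => n j)) k ()) =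
          -decoderOut K₂ Wd Wn R m (sampler h (W.response (hold (h / N) (idlift N V)))) d n := by
  have hP := realizes_firstRow W hh hN
  have h1 := ((hP.delay m).fromCols (realizes_zero (ι := Unit ⊕ Unit))).add
    ((realizes_neg_one.comp K₂.realizes).comp ((R.realizes.comp hP).fromCols
      ((R.realizes.comp Wd.realizes).fromCols Wn.realizes)))
  obtain ⟨T, hT, hF⟩ := h1
  refine ⟨T, ?_, fun V d n => ?_⟩
  · rw [hT, hRt]
    simp only [lft, plant₂, sensitivity, Matrix.toBlocks_fromBlocks₁₁,
      Matrix.toBlocks_fromBlocks₁₂, Matrix.toBlocks_fromBlocks₂₁, Matrix.toBlocks_fromBlocks₂₂,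
      Matrix.zero_mul, sub_zero, inv_one, Matrix.mul_one]
  · ext k
    rw [hF]
    change (shift m (sampler h (W.response (hold (h / N) (idlift N V)))) k + 0) +
      -K₂.filter (R.filter (sampler h (W.response (hold (h / N) (idlift N V)))) +
        (R.filter (Wd.filter d) + Wn.filter n)) k = _
    rw [decoderOut, R.filter_add, add_assoc (R.filter _), Pi.neg_apply, Pi.sub_apply]
    ring

theorem exists_family {ι : ℕ → Type} {P : ∀ N, DTSystem (ι N) Unit → Prop}
    (hP : ∀ N, 0 < N → ∃ T, P N T) : ∃ T : ∀ N, DTSystem (ι N) Unit, ∀ N, 1 ≤ N → P N (T N) := by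
  choose T hT using hP
  -- The zero system fills in at N = 0, which does not affect the limit.
  refine ⟨fun N => if hN : 0 < N then T N hN else ⟨0, 0, 0, 0, 0⟩, fun N hN => ?_⟩
  have hN' : 0 < N := hN
  simpa only [dif_pos hN'] using hT N hN'

end

theorem mainTheorem9
    (h : ℝ) (hh : 0 < h) (m : ℕ) (L : ℝ) (hL : L = m * h)
    (W : AnalogFilter) (K₁ K₂ Wd Wn : DTSystem Unit Unit)
    (hwp : 1 + K₁.D () () ≠ 0) :
    (∀ (w : ℝ → ℝ) (d : ℕ → ℝ), IsL2 w → IsEll2 d → ∃! e, EncoderError h W K₁ Wd w d e) ∧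
    (∀ (w : ℝ → ℝ) (d n : ℕ → ℝ), IsL2 w → IsEll2 d → IsEll2 n →
      ∃! er, DecoderError h L W K₁ K₂ Wd Wn w d n er) ∧
    ∃ (WN : (N : ℕ) → DTSystem (Fin N) (Fin N))
      (T₁ : (N : ℕ) → DTSystem (Fin N ⊕ Unit) Unit)
      (T₂ : (N : ℕ) → DTSystem (Fin N ⊕ (Unit ⊕ Unit)) Unit),
      (∀ N, 1 ≤ N → ∀ V : ℕ → Fin N → ℝ, (WN N).output V = fastLifted W h N V) ∧
      (∀ N, 1 ≤ N → (T₁ N).transfer = lft (plant₁ (WN N).transfer Wd) K₁.transfer) ∧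
      (∀ N, 1 ≤ N →
        (T₂ N).transfer = lft (plant₂ m (WN N).transfer K₁ Wd Wn) K₂.transfer) ∧
      Tendsto (fun N => approxNorm₁ h N (T₁ N)) atTop (𝓝 (encoderNorm h W K₁ Wd)) ∧
      Tendsto (fun N => approxNorm₂ h N (T₂ N)) atTop
        (𝓝 (decoderNorm h L W K₁ K₂ Wd Wn)) := by
  subst hL
  obtain ⟨R, hRt, hR⟩ := DTSystem.exists_sensitivity K₁ hwp
  refine ⟨fun w d _ _ => ⟨_, (encoderError_iff hR).2 rfl, fun e he => (encoderError_iff hR).1 he⟩,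
    fun w d n _ _ _ => ⟨_, (decoderError_iff hR).2 rfl, fun e he => (decoderError_iff hR).1 he⟩, ?_⟩
  obtain ⟨T₁, hT₁⟩ := exists_family fun N hN => exists_encoder_realization W K₁ Wd R hRt hh hN
  obtain ⟨T₂, hT₂⟩ := exists_family fun N hN =>
    exists_decoder_realization W K₁ K₂ Wd Wn R hRt hh m hN
  refine ⟨fun N => (W.discretize (h / N)).lifted N, T₁, T₂,
    fun N hN V => W.lifted_discretize_output hh hN V, fun N hN => (hT₁ N hN).1,
    fun N hN => (hT₂ N hN).1, ?_, ?_⟩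
  · rw [encoderNorm_eq hR]
    have hg := tendsto_gain W hh (encoderOut K₁ Wd R) energy IsEll2 (fun _ hx => hx.energy_ne_top)
      continuous_encoderOut (fun x hx => by rw [energy_eq_zero hx, encoderOut_zero])
    refine (hg.ennrpow_const (1 / 2)).congr' ?_
    filter_upwards [eventually_ge_atTop 1] with N hN
    simp only [approxNorm₁, (hT₁ N hN).2]
  · rw [decoderNorm_eq hR hh]
    have hg := tendsto_gain (X := (ℕ → ℝ) × (ℕ → ℝ)) W hh
      (fun y x => decoderOut K₂ Wd Wn R m y x.1 x.2)
      (fun x => energy x.1 + energy x.2) (fun x => IsEll2 x.1 ∧ IsEll2 x.2)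
      (fun _ ⟨hd, hn⟩ => ENNReal.add_ne_top.2 ⟨hd.energy_ne_top, hn.energy_ne_top⟩)
      (fun x => continuous_decoderOut m x.1 x.2) (fun x hx => by
        rw [add_eq_zero] at hx
        simp only [energy_eq_zero hx.1, energy_eq_zero hx.2, decoderOut_zero])
    refine (hg.ennrpow_const (1 / 2)).congr' ?_
    filter_upwards [eventually_ge_atTop 1] with N hN
    simp only [approxNorm₂, (hT₂ N hN).2, energy_neg, iSup_prod, iSup_and, add_assoc]
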